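/- Let $p$ be a prime, let $n\ge 1$, put $\delta=z\,\frac{d}{dz}$, and let $$L=\delta^n+a_{n-1}(z)\delta^{n-1}+\cdots+a_1(z)\delta+a_0(z),\qquad a_i(z)\in z\,\mathbb{Z}_p[[z]]\quad(0\le i<n),$$ be a monic differential operator over $\mathbb{Z}_p[[z]]$ that is MUM (has maximal unipotent monodromy at $0$), i.e. all $a_i$ vanish at $z=0$. Let $A$ be the companion matrix of $L$ (ones on the superdiagonal, last row $(-a_0,\ldots,-a_{n-1})$, zeros elsewhere), and put $A_0=I$ and $A_{j+1}=\delta A_j+A_j(A-jI)$ for $j\ge 0$. Let $\|C\|$ denote the maximum of the Gauss norms of the entries of a matrix $C$, where $\left|\sum_k c_kz^k\right|_{\mathcal G}=\sup_k|c_k|_p$. The generic radius of convergence $r(L)\in[0,\infty]$ is the radius of convergence of $\sum_{j\ge0}\frac{A_j}{j!\,z^j}(x-z)^j$, that is, $$\frac1{r(L)}=\limsup_{j\to\infty}\left\|\frac{A_j}{j!}\right\|^{1/j}.$$ Suppose that $r(L)\ge 1$. Then there is a unique power series $y_0\in 1+z\,\mathbb{Q}_p[[z]]$ with $L(y_0)=0$,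 and it satisfies $y_0\in 1+z\,\mathbb{Z}_p[[z]]$. -/

import Mathlib

open scoped PowerSeries ENNReal

noncomputable section

/-- The Euler derivation `δ = z d/dz` on formal power series. -/
def eulerDeriv {R : Type*} [CommRing R] (f : R⟦X⟧) : R⟦X⟧ :=
  PowerSeries.X * PowerSeries.derivative R f

/-- A monic differential operator `δ^n + a_{n-1} δ^{n-1} + ⋯ + a_1 δ + a_0` of order `n`
with coefficients in `R[[z]]`; it is given by `coeff i = a_i`. -/
structure MonicDiffOp (R : Type*) [CommRing R] (n : ℕ) where
  coeff : Fin n → R⟦X⟧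

namespace MonicDiffOp

variable {R S : Type*} [CommRing R] [CommRing S] {n : ℕ}

/-- Extension of scalars. -/
def map (φ : R →+* S) (L : MonicDiffOp R n) : MonicDiffOp S n :=
  ⟨fun i => PowerSeries.map φ (L.coeff i)⟩

/-- The action `L f = δ^n f + a_{n-1} δ^{n-1} f + ⋯ + a_0 f`. -/
def apply (L : MonicDiffOp R n) (f : R⟦X⟧) : R⟦X⟧ :=
  eulerDeriv^[n] f + ∑ i : Fin n, L.coeff i * eulerDeriv^[i] f

/-- Maximal unipotent monodromy at zero: every `a_i` lies in `z R[[z]]`. -/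
def IsMUM (L : MonicDiffOp R n) : Prop :=
  ∀ i, PowerSeries.constantCoeff (L.coeff i) = 0

/-- The companion matrix, with ones on the superdiagonal and last row
`(-a_0, …, -a_{n-1})`: `L f = 0` iff `δ v = A v` for `v = (f, δ f, …, δ^{n-1} f)ᵗ`. -/
def companion (L : MonicDiffOp R n) : Matrix (Fin n) (Fin n) R⟦X⟧ :=
  fun i j =>
    if (i : ℕ) + 1 = j then 1 else if (i : ℕ) + 1 = n then -L.coeff j else 0

/-- The matrices `A_0 = I`, `A_{j+1} = δ A_j + A_j (A - j I)`, where `A` is the companion matrix.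
The fundamental matrix at the generic point of the system attached to `L` is
`U = ∑_j A_j / (j! z^j) (x - z)^j`. -/
def taylorMatrix (L : MonicDiffOp R n) : ℕ → Matrix (Fin n) (Fin n) R⟦X⟧
  | 0 => 1
  | j + 1 => (taylorMatrix L j).map eulerDeriv +
      taylorMatrix L j * (L.companion - (j : Matrix (Fin n) (Fin n) R⟦X⟧))

end MonicDiffOp

variable {p : ℕ} [Fact p.Prime]

/-- The Gauss norm `sup_k |a_k|` of a power series over `ℚ_p` (`∞` if it is unbounded). -/
def gaussENorm (f : ℚ_[p]⟦X⟧) : ℝ≥0∞ :=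
  ⨆ k : ℕ, ‖PowerSeries.coeff k f‖ₑ

/-- The norm `‖C‖` of a matrix: the largest Gauss norm of an entry. -/
def matrixGaussENorm {n : ℕ} (C : Matrix (Fin n) (Fin n) ℚ_[p]⟦X⟧) : ℝ≥0∞ :=
  ⨆ i, ⨆ j, gaussENorm (C i j)

/-- The generic radius of convergence `r(L) ∈ [0, ∞]`, that is the radius of convergence in
`x - z` of the matrix `U`: `1 / r(L) = limsup_j ‖A_j / j!‖^{1/j}`
(the factors `z^{-j}` have Gauss norm one). -/
def MonicDiffOp.genericRadius {n : ℕ} (L : MonicDiffOp ℚ_[p] n) : ℝ≥0∞ :=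
  (Filter.limsup
    (fun j : ℕ =>
      matrixGaussENorm (PowerSeries.C ((j.factorial : ℚ_[p])⁻¹) • L.taylorMatrix j) ^ (1 / (j : ℝ)))
    Filter.atTop)⁻¹

end

/-!
Existence and uniqueness of `y₀` are a recursion on coefficients: the `k`-th coefficient gets
multiplied by `k ^ n`. Integrality rests on the Frobenius antecedent, in the following form.

*Setting.* Write all solutions of `L` at once as `y z ^ Ξ`, where `Ξ` is a nilpotent Jordan block and
`y` is a vector of power series over `ℚ_p` (`exists_frobenius_solution`). The operator
`∇ w = δ w + Ξ w` (`connection`) acts on `k`-th coefficients as `k + Ξ`, and `y`, `∇ y`, …,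
`∇ ^ (n - 1) y` are independent over the power series (`cyclicComb_eq_zero`), so that their span is
the differential module of `L`. Inside it lies the lattice spanned over `ℤ_p⟦z⟧`; it is stable under
`∇`, as `L` has integral coefficients. The first row of `A_j` contains the coordinates of
`∇ (∇ - 1) ⋯ (∇ - j + 1) y`, so `r(L) ≥ 1` says that the coordinates of `binom(∇, j) y` grow
subexponentially (`HasSubexpGrowth`). The solution `y₀` is the first entry of `y`.

*Descent.* Let `h(z) = y₁(z ^ p)` be the part of `y` in exponents divisible by `p`. For each `j` the
function on `ℕ` equal to `binom(k / p, j)` at multiples `k` of `p` and to `0` elsewhere has a Mahler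
series with rapidly decreasing coefficients (`pow_dvd_frobeniusMahler`). Evaluating it at `∇` shows
that `binom(∇ / p, j) h` is a limit of elements of a bounded lattice, hence lies in it by compactness
(`inLattice_frobenius`). For `j = 0` this says that `h` lies in the integral lattice of `y`; since
`h(0) = y(0)`, the vectors `∇ ^ i h` form another basis of that lattice
(`IsGoodCyclic.inLattice_vecExpand`). For varying `j` it says that `y₁` has subexponential growth
for `∇ / p`, which is the connection in the variable `z ^ p`, with exponent matrix `Ξ / p`.

*Integrality of the descended operator.* The vector `y₁` is killed by a monic operator of order `n`
with bounded coefficients. By the growth condition the vectors `∇ (∇ - 1) ⋯ (∇ - j + 1) y₁` are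
bounded, so that `y₁` is killed by some monic operator with integral coefficients, `ℤ_p⟦z⟧` being
Noetherian (`exists_eq_sum_of_bddBy`). Gauss's lemma for differential operators then makes the
operator of order `n` integral (`bddBy_one_of_monic`). Thus `y₁` satisfies all the hypotheses
made on `y` (`IsGoodCyclic.antecedent`).

*Conclusion.* As `y` is an integral combination of the `∇ ^ i h`, the `k`-th coefficient of `y₀` is an
integral combination of the coefficients of index at most `k / p` of the corresponding solution
attached to `y₁`, and induction on `k` applies (`IsGoodCyclic.norm_dotProduct_le_one`).
-/

noncomputable section

/-! ### Mahler coefficients of the indicator function of `p ℕ` -/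

section Mahler

open Polynomial

/-- The function `ℕ → ℤ` sending `p k` to the binomial coefficient `k.choose j`, and vanishing
off the multiples of `p`. -/
def frobeniusChoose (p j k : ℕ) : ℤ := if p ∣ k then ((k / p).choose j : ℤ) else 0

/-- The linear functional on `ℤ[X]` with `X ^ k ↦ frobeniusChoose p j k`. -/
def frobeniusFunctional (p j : ℕ) : ℤ[X] →ₗ[ℤ] ℤ :=
  Polynomial.lsum fun k => LinearMap.toSpanSingleton ℤ ℤ (frobeniusChoose p j k)

lemma frobeniusFunctional_X_pow (p j k : ℕ) :
    frobeniusFunctional p j (X ^ k) = frobeniusChoose p j k := by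
  rw [frobeniusFunctional, ← monomial_one_right_eq_X_pow, Polynomial.lsum_apply,
    Polynomial.sum_monomial_index] <;> simp

lemma frobeniusChoose_add_zero (p k : ℕ) :
    frobeniusChoose p 0 (k + p) = frobeniusChoose p 0 k := by
  simp [frobeniusChoose]

lemma frobeniusChoose_add_succ {p : ℕ} (hp : 0 < p) (j k : ℕ) :
    frobeniusChoose p (j + 1) (k + p) =
      frobeniusChoose p (j + 1) k + frobeniusChoose p j k := by
  simp only [frobeniusChoose, Nat.dvd_add_self_right, Nat.add_div_right _ hp]
  split_ifs
  · rw [Nat.choose_succ_succ]; push_cast; ring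
  · simp

lemma frobeniusFunctional_zero_mul (p : ℕ) (g : ℤ[X]) :
    frobeniusFunctional p 0 ((X ^ p - 1) * g) = 0 := by
  induction g using Polynomial.induction_on' with
  | add f g hf hg => rw [mul_add, map_add, hf, hg, add_zero]
  | monomial k a =>
    have : (X ^ p - 1) * monomial k a = a • (X ^ (k + p) - X ^ k : ℤ[X]) := by
      rw [← C_mul_X_pow_eq_monomial, smul_eq_C_mul]; ring
    rw [this, map_smul, map_sub, frobeniusFunctional_X_pow, frobeniusFunctional_X_pow,
      frobeniusChoose_add_zero, sub_self, smul_zero]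

lemma frobeniusFunctional_succ_mul {p : ℕ} (hp : 0 < p) (j : ℕ) (g : ℤ[X]) :
    frobeniusFunctional p (j + 1) ((X ^ p - 1) * g) = frobeniusFunctional p j g := by
  induction g using Polynomial.induction_on' with
  | add f g hf hg => rw [mul_add, map_add, hf, hg, map_add]
  | monomial k a =>
    have : (X ^ p - 1) * monomial k a = a • (X ^ (k + p) - X ^ k : ℤ[X]) := by
      rw [← C_mul_X_pow_eq_monomial, smul_eq_C_mul]; ring
    have h2 : (monomial k a : ℤ[X]) = a • X ^ k := by
      rw [← C_mul_X_pow_eq_monomial, smul_eq_C_mul]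
    rw [this, h2, map_smul, map_smul, map_sub, frobeniusFunctional_X_pow,
      frobeniusFunctional_X_pow, frobeniusFunctional_X_pow, frobeniusChoose_add_succ hp]
    congr 1; ring

/-- The functional decays `p`-adically along powers of `X - 1`: one has
`(X - 1) ^ p = (X ^ p - 1) - p (X - 1) r`, and multiplication by `X ^ p - 1` lowers `j` by one. -/
lemma pow_dvd_frobeniusFunctional {p : ℕ} (hp : p.Prime) (i : ℕ) :
    ∀ (j a : ℕ) (g : ℤ[X]), p * j + (p - 1) * a + 1 ≤ i →
      (p : ℤ) ^ a ∣ frobeniusFunctional p j ((X - 1) ^ i * g) := by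
  induction i using Nat.strong_induction_on with
  | _ i ih =>
  intro j a g hi
  obtain _ | a := a
  · simp
  have hp2 := hp.two_le
  have hmul : (p - 1) * (a + 1) = (p - 1) * a + (p - 1) := by ring
  have hpi : p ≤ i := by omega
  obtain ⟨r, hr⟩ := exists_add_pow_prime_eq hp (X - 1 : ℤ[X]) 1
  have key : (X - 1 : ℤ[X]) ^ i * g = (X ^ p - 1) * ((X - 1) ^ (i - p) * g) -
      (p : ℤ) • ((X - 1) ^ (i - p + 1) * (r * g)) := by
    have hX : (X - 1 : ℤ[X]) ^ p = (X ^ p - 1) - (p : ℤ[X]) * (X - 1) * r := by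
      rw [sub_add_cancel, one_pow, mul_one] at hr
      rw [hr]; ring
    have : (X - 1 : ℤ[X]) ^ i = (X - 1) ^ p * (X - 1) ^ (i - p) := by
      rw [← pow_add]; congr 1; omega
    rw [this, hX, smul_eq_C_mul]
    simp only [eq_intCast, Int.cast_natCast]
    ring
  rw [key, map_sub, map_smul]
  refine dvd_sub ?_ ?_
  · obtain _ | j := j
    · rw [frobeniusFunctional_zero_mul]; exact dvd_zero _
    · rw [frobeniusFunctional_succ_mul hp.pos]
      refine ih _ (by omega) j (a + 1) g ?_
      have : p * (j + 1) = p * j + p := by ring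
      omega
  · rw [smul_eq_mul, pow_succ']
    exact mul_dvd_mul_left _ (ih _ (by omega) j a _ (by omega))

/-- The Mahler coefficients of `frobeniusChoose p j`, see `frobeniusChoose_eq_sum`. -/
def frobeniusMahler (p j i : ℕ) : ℤ := frobeniusFunctional p j ((X - 1) ^ i)

lemma pow_dvd_frobeniusMahler {p : ℕ} (hp : p.Prime) {i j a : ℕ}
    (h : p * j + (p - 1) * a + 1 ≤ i) : (p : ℤ) ^ a ∣ frobeniusMahler p j i := by
  simpa [frobeniusMahler] using pow_dvd_frobeniusFunctional hp i j a 1 h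

lemma frobeniusChoose_eq_sum (p j k : ℕ) :
    frobeniusChoose p j k = ∑ i ∈ Finset.range (k + 1), frobeniusMahler p j i * k.choose i := by
  rw [← frobeniusFunctional_X_pow]
  have : (X : ℤ[X]) ^ k = ∑ i ∈ Finset.range (k + 1), (k.choose i : ℤ) • (X - 1) ^ i := by
    conv_lhs => rw [← sub_add_cancel (X : ℤ[X]) 1, add_pow]
    refine Finset.sum_congr rfl fun i _ => ?_
    rw [one_pow, mul_one, smul_eq_C_mul, mul_comm]
    simp
  rw [this, map_sum]
  refine Finset.sum_congr rfl fun i _ => ?_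
  rw [map_smul, smul_eq_mul, mul_comm, frobeniusMahler]

end Mahler

/-! ### Convergence of Mahler series in the coefficients -/

section Interpolation

open Polynomial

/-- The binomial coefficient polynomial `X (X - 1) ⋯ (X - j + 1) / j!`. -/
def binomPoly (K : Type*) [Field K] (j : ℕ) : K[X] := C (j.factorial : K)⁻¹ * descPochhammer K j

lemma binomPoly_eval_natCast {K : Type*} [Field K] [CharZero K] (j k : ℕ) :
    (binomPoly K j).eval (k : K) = k.choose j := by
  rw [binomPoly, eval_mul, eval_C, descPochhammer_eval_eq_descFactorial,
    Nat.descFactorial_eq_factorial_mul_choose]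
  have : (j.factorial : K) ≠ 0 := by exact_mod_cast j.factorial_ne_zero
  push_cast; field_simp

lemma binomPoly_natDegree_le {K : Type*} [Field K] (j : ℕ) : (binomPoly K j).natDegree ≤ j := by
  refine (natDegree_C_mul_le _ _).trans ?_
  rw [descPochhammer_natDegree]

variable {p : ℕ} [Fact p.Prime]

lemma Padic.norm_natCast_inv_le {x : ℕ} (hx : x ≠ 0) : ‖(x : ℚ_[p])‖⁻¹ ≤ x := by
  have h := Padic.norm_eq_zpow_neg_valuation (p := p) (x := (x : ℚ_[p])) (by exact_mod_cast hx)
  rw [h, Padic.valuation_natCast, zpow_neg, inv_inv, zpow_natCast]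
  exact_mod_cast Nat.le_of_dvd (Nat.pos_of_ne_zero hx) pow_padicValNat_dvd

/-- A polynomial of degree at most `d` which is small at `0, 1, …, d` has small coefficients;
the factor `d ^ l` is the price of division by the integers `1, …, d`. -/
lemma Polynomial.norm_coeff_le_of_eval_le (l : ℕ) : ∀ (F : ℚ_[p][X]) (d : ℕ) (ε : ℝ),
    F.natDegree ≤ d → (∀ x : ℕ, x ≤ d → ‖F.eval (x : ℚ_[p])‖ ≤ ε) → ‖F.coeff l‖ ≤ ε * d ^ l := by
  induction l with
  | zero =>
    intro F d ε _ h
    simpa [coeff_zero_eq_eval_zero] using h 0 (Nat.zero_le _)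
  | succ l ih =>
    intro F d ε hd h
    have hε : 0 ≤ ε := (norm_nonneg _).trans (h 0 (Nat.zero_le _))
    obtain _ | e := d
    · rw [coeff_eq_zero_of_natDegree_lt (by omega)]; simp
    have hG : F.divX.natDegree ≤ e := by rw [natDegree_divX_eq_natDegree_tsub_one]; omega
    have h1 : ∀ x : ℕ, x ≠ 0 → x ≤ e + 1 → ‖F.divX.eval (x : ℚ_[p])‖ ≤ ε * (e + 1 : ℕ) := by
      intro x hx hxe
      have hx' : (x : ℚ_[p]) ≠ 0 := by exact_mod_cast hx
      have : F.divX.eval (x : ℚ_[p]) = (F.eval (x : ℚ_[p]) - F.eval ((0 : ℕ) : ℚ_[p])) * (x : ℚ_[p])⁻¹ := by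
        conv_rhs => rw [← divX_mul_X_add F]
        simp only [eval_add, eval_mul, eval_X, eval_C, Nat.cast_zero, mul_zero, zero_add]
        field_simp
        ring
      rw [this, norm_mul, norm_inv]
      refine mul_le_mul ?_ ((Padic.norm_natCast_inv_le hx).trans (by exact_mod_cast hxe))
        (by positivity) hε
      rw [sub_eq_add_neg]
      refine (IsUltrametricDist.norm_add_le_max _ _).trans (max_le (h x hxe) ?_)
      rw [norm_neg]
      exact h 0 (Nat.zero_le _)
    -- the value at `0` is controlled by the others, as the `(e + 1)`-st difference vanishes
    have h0 : ‖F.divX.eval ((0 : ℕ) : ℚ_[p])‖ ≤ ε * (e + 1 : ℕ) := by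
      have hΔ := congrFun (F.divX.fwdDiff_iter_eq_zero_of_degree_lt (n := e + 1) (by omega)) 0
      rw [fwdDiff_iter_eq_sum_shift, Finset.sum_range_succ'] at hΔ
      have hΔ' := eq_neg_of_add_eq_zero_right hΔ
      have hn : ‖F.divX.eval ((0 : ℕ) : ℚ_[p])‖ =
          ‖((-1 : ℤ) ^ (e + 1 - 0) * ((e + 1).choose 0 : ℤ)) •
            F.divX.eval ((0 : ℚ_[p]) + 0 • 1)‖ := by
        rw [zsmul_eq_mul]
        simp
      rw [hn, hΔ', norm_neg]
      refine IsUltrametricDist.norm_sum_le_of_forall_le_of_nonneg (by positivity) fun k hk => ?_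
      rw [zsmul_eq_mul, norm_mul]
      refine (mul_le_of_le_one_left (norm_nonneg _) (Padic.norm_int_le_one _)).trans ?_
      have := h1 (k + 1) (by omega) (by simpa using Finset.mem_range.mp hk)
      simpa using this
    have := ih F.divX e (ε * (e + 1 : ℕ)) hG fun x hx => by
      rcases eq_or_ne x 0 with rfl | hx0
      · exact h0
      · exact h1 x hx0 (by omega)
    rw [coeff_divX] at this
    refine this.trans ?_
    rw [pow_succ' ((e + 1 : ℕ) : ℝ), ← mul_assoc]
    gcongr
    omega

/-- The truncated Mahler series of `frobeniusChoose p j`. -/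
def frobeniusPoly (p : ℕ) [Fact p.Prime] (j I : ℕ) : ℚ_[p][X] :=
  ∑ i ∈ Finset.range (I + 1), C (frobeniusMahler p j i : ℚ_[p]) * binomPoly ℚ_[p] i

/-- The polynomial interpolating `frobeniusChoose p j` on the class of `k` modulo `p`. -/
def frobeniusLocal (p : ℕ) [Fact p.Prime] (j k : ℕ) : ℚ_[p][X] :=
  if p ∣ k then (binomPoly ℚ_[p] j).comp (C (p : ℚ_[p])⁻¹ * X) else 0

lemma Padic.norm_frobeniusMahler_le {i j a : ℕ} (h : p * j + (p - 1) * a + 1 ≤ i) :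
    ‖(frobeniusMahler p j i : ℚ_[p])‖ ≤ ((p : ℝ)⁻¹) ^ a := by
  have h1 := pow_dvd_frobeniusMahler (Fact.out : p.Prime) h
  have h2 := (Padic.norm_int_le_pow_iff_dvd (p := p) (frobeniusMahler p j i) a).2
    (by exact_mod_cast h1)
  simpa [zpow_neg, inv_pow] using h2

/-- The truncated Mahler series is uniformly close to `frobeniusChoose p j` on `ℕ`. -/
lemma norm_eval_frobeniusPoly_sub (j a x : ℕ) :
    ‖(frobeniusPoly p j (p * j + (p - 1) * a)).eval (x : ℚ_[p]) - frobeniusChoose p j x‖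
      ≤ ((p : ℝ)⁻¹) ^ a := by
  set I := p * j + (p - 1) * a
  have hpoly : ∀ N, (frobeniusPoly p j N).eval (x : ℚ_[p]) =
      ∑ i ∈ Finset.range (N + 1), (frobeniusMahler p j i : ℚ_[p]) * x.choose i := by
    intro N
    simp [frobeniusPoly, eval_finsetSum, binomPoly_eval_natCast]
  have hf : (frobeniusChoose p j x : ℚ_[p]) =
      ∑ i ∈ Finset.range (I + x + 1), (frobeniusMahler p j i : ℚ_[p]) * x.choose i := by
    rw [frobeniusChoose_eq_sum]
    push_cast
    refine Finset.sum_subset (by intro i; simp; omega) fun i _ hi => ?_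
    rw [Nat.choose_eq_zero_of_lt (by simpa using hi)]; simp
  rw [hpoly, hf, norm_sub_rev, ← Finset.sum_sdiff_eq_sub (by intro i; simp; omega)]
  refine IsUltrametricDist.norm_sum_le_of_forall_le_of_nonneg (by positivity) fun i hi => ?_
  rw [norm_mul]
  have hi' : I + 1 ≤ i := by
    have := (Finset.mem_sdiff.mp hi).2
    simpa using this
  calc _ ≤ ((p : ℝ)⁻¹) ^ a * 1 := by
        refine mul_le_mul (Padic.norm_frobeniusMahler_le hi') ?_ (norm_nonneg _) (by positivity)
        exact_mod_cast Padic.norm_int_le_one (p := p) (x.choose i : ℤ)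
    _ = _ := mul_one _

lemma frobeniusPoly_natDegree_le (j I : ℕ) : (frobeniusPoly p j I).natDegree ≤ I := by
  refine natDegree_sum_le_of_forall_le _ _ fun i hi => ?_
  refine (natDegree_C_mul_le _ _).trans ((binomPoly_natDegree_le i).trans ?_)
  have := Finset.mem_range.mp hi
  omega

lemma frobeniusLocal_natDegree_le (j k : ℕ) : (frobeniusLocal p j k).natDegree ≤ j := by
  rw [frobeniusLocal]
  split_ifs
  · refine natDegree_comp_le.trans ?_
    have h1 : (C (p : ℚ_[p])⁻¹ * X).natDegree ≤ 1 := (natDegree_C_mul_le _ _).trans natDegree_X_le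
    calc _ ≤ j * 1 := Nat.mul_le_mul (binomPoly_natDegree_le j) h1
      _ = j := mul_one j
  · simp

lemma frobeniusLocal_eval (j k x : ℕ) :
    (frobeniusLocal p j k).eval ((k + p * x : ℕ) : ℚ_[p]) = frobeniusChoose p j (k + p * x) := by
  have hp : p ≠ 0 := (Fact.out : p.Prime).ne_zero
  have hpK : (p : ℚ_[p]) ≠ 0 := by exact_mod_cast hp
  rw [frobeniusLocal, frobeniusChoose]
  simp only [Nat.dvd_add_left (Dvd.intro x rfl : p ∣ p * x)]
  split_ifs with h
  · obtain ⟨m, rfl⟩ := h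
    have h1 : p * m + p * x = p * (m + x) := by ring
    rw [h1, Nat.mul_div_cancel_left _ (Nat.pos_of_ne_zero hp), eval_comp]
    have : (C (p : ℚ_[p])⁻¹ * X).eval ((p * (m + x) : ℕ) : ℚ_[p]) = ((m + x : ℕ) : ℚ_[p]) := by
      rw [eval_mul, eval_C, eval_X]; push_cast; field_simp
    rw [this, binomPoly_eval_natCast]; simp
  · simp

/-- The Mahler series of `frobeniusChoose p j` converges, together with all its derivatives, to the
polynomial which represents that function near `k`. -/
lemma tendsto_coeff_frobeniusPoly (j k l : ℕ) :
    Filter.Tendsto (fun a : ℕ =>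
      ((frobeniusPoly p j (p * j + (p - 1) * a)).comp (C (k : ℚ_[p]) + X)).coeff l)
      Filter.atTop (nhds (((frobeniusLocal p j k).comp (C (k : ℚ_[p]) + X)).coeff l)) := by
  have hp : p ≠ 0 := (Fact.out : p.Prime).ne_zero
  have hpK : (p : ℚ_[p]) ≠ 0 := by exact_mod_cast hp
  rw [tendsto_iff_norm_sub_tendsto_zero]
  set M : ℕ := p * j + p
  have hbound : ∀ a : ℕ,
      ‖((frobeniusPoly p j (p * j + (p - 1) * a)).comp (C (k : ℚ_[p]) + X)).coeff l -
        ((frobeniusLocal p j k).comp (C (k : ℚ_[p]) + X)).coeff l‖ ≤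
      (‖(p : ℚ_[p]) ^ l‖⁻¹ * (M : ℝ) ^ l * p) * (((a + 1 : ℕ) : ℝ) ^ l * ((p : ℝ)⁻¹) ^ (a + 1)) := by
    intro a
    set I := p * j + (p - 1) * a with hI
    set D : ℚ_[p][X] := (frobeniusPoly p j I - frobeniusLocal p j k).comp (C (k : ℚ_[p]) + X)
    have hjI : j ≤ I := le_trans (Nat.le_mul_of_pos_left j (Nat.pos_of_ne_zero hp)) (by omega)
    have hdegD : (D.comp (C (p : ℚ_[p]) * X)).natDegree ≤ I := by
      have h1 : (C (p : ℚ_[p]) * X).natDegree ≤ 1 := (natDegree_C_mul_le _ _).trans natDegree_X_le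
      have h2 : (C (k : ℚ_[p]) + X).natDegree ≤ 1 := by rw [add_comm, natDegree_X_add_C]
      have h3 : (frobeniusPoly p j I - frobeniusLocal p j k).natDegree ≤ I :=
        (natDegree_sub_le _ _).trans
          (max_le (frobeniusPoly_natDegree_le j I) ((frobeniusLocal_natDegree_le j k).trans hjI))
      calc _ ≤ _ := natDegree_comp_le
        _ ≤ (I * 1) * 1 := Nat.mul_le_mul (natDegree_comp_le.trans (Nat.mul_le_mul h3 h2)) h1
        _ = I := by ring
    -- the interpolation bound applies after `X ↦ p X`, as the two polynomials are only known to be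
    -- close on the class of `k` modulo `p`
    have h := Polynomial.norm_coeff_le_of_eval_le l (D.comp (C (p : ℚ_[p]) * X)) I
      (((p : ℝ)⁻¹) ^ a) hdegD fun x _ => by
        have := norm_eval_frobeniusPoly_sub (p := p) j a (k + p * x)
        rw [← frobeniusLocal_eval, ← eval_sub] at this
        simpa [D, eval_comp, hI] using this
    rw [comp_C_mul_X_coeff, norm_mul] at h
    have hD : D.coeff l = ((frobeniusPoly p j I).comp (C (k : ℚ_[p]) + X)).coeff l -
        ((frobeniusLocal p j k).comp (C (k : ℚ_[p]) + X)).coeff l := by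
      rw [← coeff_sub, ← sub_comp]
    rw [← hD]
    have hpos : 0 < ‖(p : ℚ_[p]) ^ l‖ := norm_pos_iff.2 (pow_ne_zero _ hpK)
    have hIM : (I : ℝ) ≤ M * (a + 1 : ℕ) := by
      have : I ≤ M * (a + 1) := by
        have h1 : (p - 1) * a ≤ p * a := Nat.mul_le_mul_right _ (Nat.sub_le _ _)
        have h2 : M * (a + 1) = p * j * a + p * j + p * a + p := by simp only [M]; ring
        rw [h2, hI]
        have : 0 ≤ p * j * a := Nat.zero_le _
        omega
      exact_mod_cast this
    have hp1 : (p : ℝ) * ((p : ℝ)⁻¹) ^ (a + 1) = ((p : ℝ)⁻¹) ^ a := by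
      have : (p : ℝ) ≠ 0 := by exact_mod_cast hp
      rw [pow_succ']; field_simp
    calc ‖D.coeff l‖ = ‖(p : ℚ_[p]) ^ l‖⁻¹ * (‖D.coeff l‖ * ‖(p : ℚ_[p]) ^ l‖) := by
          field_simp
      _ ≤ ‖(p : ℚ_[p]) ^ l‖⁻¹ * (((p : ℝ)⁻¹) ^ a * (M * (a + 1 : ℕ)) ^ l) := by
          refine mul_le_mul_of_nonneg_left (h.trans ?_) (by positivity)
          gcongr
      _ = _ := by rw [mul_pow, ← hp1]; ring
  refine squeeze_zero (fun _ => norm_nonneg _) hbound ?_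
  rw [← mul_zero (‖(p : ℚ_[p]) ^ l‖⁻¹ * (M : ℝ) ^ l * p)]
  refine Filter.Tendsto.const_mul _ ?_
  have hlt : |(p : ℝ)⁻¹| < 1 := by
    rw [abs_of_nonneg (by positivity)]
    exact inv_lt_one_of_one_lt₀ (by exact_mod_cast (Fact.out : p.Prime).one_lt)
  exact (tendsto_pow_const_mul_const_pow_of_abs_lt_one l hlt).comp (Filter.tendsto_add_atTop_nat 1)

end Interpolation

/-! ### The Euler derivation -/

section EulerDeriv

variable {R S : Type*} [CommRing R] [CommRing S]

lemma coeff_eulerDeriv (f : R⟦X⟧) (k : ℕ) :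
    PowerSeries.coeff k (eulerDeriv f) = k * PowerSeries.coeff k f := by
  obtain _ | k := k
  · simp [eulerDeriv]
  · rw [eulerDeriv, PowerSeries.coeff_succ_X_mul, PowerSeries.coeff_derivative]
    push_cast; ring

lemma eulerDeriv_add (f g : R⟦X⟧) : eulerDeriv (f + g) = eulerDeriv f + eulerDeriv g := by
  ext k; simp only [coeff_eulerDeriv, map_add]; ring

lemma eulerDeriv_zero : eulerDeriv (0 : R⟦X⟧) = 0 := by
  ext k; simp [coeff_eulerDeriv]

lemma eulerDeriv_smul (c : R) (f : R⟦X⟧) : eulerDeriv (c • f) = c • eulerDeriv f := by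
  ext k; simp only [coeff_eulerDeriv, PowerSeries.coeff_smul]; ring

lemma eulerDeriv_mul (f g : R⟦X⟧) :
    eulerDeriv (f * g) = eulerDeriv f * g + f * eulerDeriv g := by
  simp only [eulerDeriv, Derivation.leibniz, smul_eq_mul]; ring

lemma map_eulerDeriv (φ : R →+* S) (f : R⟦X⟧) :
    PowerSeries.map φ (eulerDeriv f) = eulerDeriv (PowerSeries.map φ f) := by
  ext k; simp [coeff_eulerDeriv]

end EulerDeriv

/-! ### Constant connections and cyclic vectors -/

section Connection

open Polynomial

variable {K : Type*} [Field K] {n : ℕ}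

/-- The connection `∇ w = δ w + Ξ w` with constant matrix `Ξ` on vectors of power series; formally
it is the action of `δ` on `w z ^ Ξ`. -/
def connection (Ξ : Matrix (Fin n) (Fin n) K) : Module.End K (Fin n → K⟦X⟧) where
  toFun w l := eulerDeriv (w l) + ∑ m, Ξ l m • w m
  map_add' v w := by
    ext l : 1
    simp only [Pi.add_apply, eulerDeriv_add, smul_add, Finset.sum_add_distrib]; ring
  map_smul' c w := by
    ext l : 1
    simp only [Pi.smul_apply, eulerDeriv_smul, RingHom.id_apply, smul_add, Finset.smul_sum,
      smul_comm c]

lemma connection_apply (Ξ : Matrix (Fin n) (Fin n) K) (w : Fin n → K⟦X⟧) (l : Fin n) :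
    connection Ξ w l = eulerDeriv (w l) + ∑ m, Ξ l m • w m := rfl

lemma connection_smul (Ξ : Matrix (Fin n) (Fin n) K) (f : K⟦X⟧) (w : Fin n → K⟦X⟧) :
    connection Ξ (f • w) = eulerDeriv f • w + f • connection Ξ w := by
  ext l : 1
  simp only [connection_apply, Pi.smul_apply, Pi.add_apply, smul_eq_mul, eulerDeriv_mul, mul_add,
    Finset.mul_sum, mul_smul_comm, add_assoc]

/-- The vector of the `k`-th coefficients. -/
def vecCoeff (k : ℕ) : (Fin n → K⟦X⟧) →ₗ[K] (Fin n → K) where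
  toFun w l := PowerSeries.coeff k (w l)
  map_add' v w := by ext l; simp
  map_smul' c w := by ext l; simp

lemma vecCoeff_apply (k : ℕ) (w : Fin n → K⟦X⟧) (l : Fin n) :
    vecCoeff k w l = PowerSeries.coeff k (w l) := rfl

lemma vecCoeff_ext {v w : Fin n → K⟦X⟧} (h : ∀ k, vecCoeff k v = vecCoeff k w) : v = w := by
  ext l k
  exact congrFun (h k) l

lemma vecCoeff_smul (k : ℕ) (f : K⟦X⟧) (w : Fin n → K⟦X⟧) :
    vecCoeff k (f • w) =
      ∑ x ∈ Finset.HasAntidiagonal.antidiagonal k, PowerSeries.coeff x.1 f • vecCoeff x.2 w := by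
  ext l
  simp [vecCoeff_apply, PowerSeries.coeff_mul, Finset.sum_apply]

lemma vecCoeff_connection (Ξ : Matrix (Fin n) (Fin n) K) (k : ℕ) (w : Fin n → K⟦X⟧) :
    vecCoeff k (connection Ξ w) =
      (algebraMap K (Matrix (Fin n) (Fin n) K) (k : K) + Ξ).mulVec (vecCoeff k w) := by
  ext l
  rw [Matrix.add_mulVec, Algebra.algebraMap_eq_smul_one, Matrix.smul_mulVec, Matrix.one_mulVec]
  simp [vecCoeff_apply, connection_apply, coeff_eulerDeriv, Matrix.mulVec, dotProduct]

lemma vecCoeff_aeval (Ξ : Matrix (Fin n) (Fin n) K) (k : ℕ) (q : K[X]) (w : Fin n → K⟦X⟧) :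
    vecCoeff k (aeval (connection Ξ) q w) =
      (aeval (algebraMap K (Matrix (Fin n) (Fin n) K) (k : K) + Ξ) q).mulVec (vecCoeff k w) := by
  induction q using Polynomial.induction_on generalizing w with
  | C a =>
    rw [aeval_C, aeval_C, Module.algebraMap_end_apply, map_smul, Algebra.algebraMap_eq_smul_one,
      Matrix.smul_mulVec, Matrix.one_mulVec]
  | add f g hf hg =>
    rw [map_add, LinearMap.add_apply, map_add, hf, hg, map_add, Matrix.add_mulVec]
  | monomial m a h =>
    rw [pow_succ, ← mul_assoc, map_mul, Module.End.mul_apply, h, map_mul _ (C a * X ^ m) X,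
      ← Matrix.mulVec_mulVec, aeval_X, aeval_X, vecCoeff_connection]

lemma vecCoeff_connection_pow (Ξ : Matrix (Fin n) (Fin n) K) (k m : ℕ) (w : Fin n → K⟦X⟧) :
    vecCoeff k ((connection Ξ ^ m) w) =
      ((algebraMap K (Matrix (Fin n) (Fin n) K) (k : K) + Ξ) ^ m).mulVec (vecCoeff k w) := by
  simpa using vecCoeff_aeval Ξ k (X ^ m) w

/-- Taylor expansion of a polynomial in `k + Ξ`, with `Ξ` nilpotent. -/
lemma aeval_algebraMap_add {Ξ : Matrix (Fin n) (Fin n) K} (hΞ : Ξ ^ n = 0) (c : K) (q : K[X]) :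
    aeval (algebraMap K (Matrix (Fin n) (Fin n) K) c + Ξ) q =
      ∑ l ∈ Finset.range n, (q.comp (C c + X)).coeff l • Ξ ^ l := by
  have h : aeval (algebraMap K (Matrix (Fin n) (Fin n) K) c + Ξ) q = aeval Ξ (q.comp (C c + X)) := by
    rw [aeval_comp]; simp
  rw [h]
  set r := q.comp (C c + X)
  rw [aeval_eq_sum_range' (n := n + (r.natDegree + 1)) (by omega), Finset.sum_range_add]
  simp [pow_add, hΞ]

/-- The combination `∑ g i ∇ ^ i y`. -/
def cyclicComb (Ξ : Matrix (Fin n) (Fin n) K) (y : Fin n → K⟦X⟧) (g : Fin n → K⟦X⟧) :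
    Fin n → K⟦X⟧ :=
  ∑ i : Fin n, g i • (connection Ξ ^ (i : ℕ)) y

lemma cyclicComb_add (Ξ : Matrix (Fin n) (Fin n) K) (y g g' : Fin n → K⟦X⟧) :
    cyclicComb Ξ y (g + g') = cyclicComb Ξ y g + cyclicComb Ξ y g' := by
  simp [cyclicComb, add_smul, Finset.sum_add_distrib]

lemma cyclicComb_sub (Ξ : Matrix (Fin n) (Fin n) K) (y g g' : Fin n → K⟦X⟧) :
    cyclicComb Ξ y (g - g') = cyclicComb Ξ y g - cyclicComb Ξ y g' := by
  simp [cyclicComb, sub_smul, Finset.sum_sub_distrib]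

lemma cyclicComb_smul (Ξ : Matrix (Fin n) (Fin n) K) (y : Fin n → K⟦X⟧) (f : K⟦X⟧)
    (g : Fin n → K⟦X⟧) : cyclicComb Ξ y (f • g) = f • cyclicComb Ξ y g := by
  simp [cyclicComb, mul_smul, Finset.smul_sum]

lemma cyclicComb_const_smul (Ξ : Matrix (Fin n) (Fin n) K) (y : Fin n → K⟦X⟧) (c : K)
    (g : Fin n → K⟦X⟧) : cyclicComb Ξ y (c • g) = c • cyclicComb Ξ y g := by
  simp [cyclicComb, Finset.smul_sum]

lemma cyclicComb_sum (Ξ : Matrix (Fin n) (Fin n) K) (y : Fin n → K⟦X⟧) {ι : Type*} (s : Finset ι)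
    (g : ι → Fin n → K⟦X⟧) : cyclicComb Ξ y (∑ i ∈ s, g i) = ∑ i ∈ s, cyclicComb Ξ y (g i) := by
  simp only [cyclicComb, Finset.sum_apply, Finset.sum_smul]
  exact Finset.sum_comm

lemma cyclicComb_single (Ξ : Matrix (Fin n) (Fin n) K) (y : Fin n → K⟦X⟧) (i : Fin n) :
    cyclicComb Ξ y (Pi.single i 1) = (connection Ξ ^ (i : ℕ)) y := by
  rw [cyclicComb, Finset.sum_eq_single i]
  · simp
  · intro j _ hj; simp [Pi.single_eq_of_ne hj]
  · simp

lemma vecCoeff_zero_cyclicComb (Ξ : Matrix (Fin n) (Fin n) K) (y g : Fin n → K⟦X⟧) :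
    vecCoeff 0 (cyclicComb Ξ y g) =
      ∑ i : Fin n, PowerSeries.constantCoeff (g i) • (Ξ ^ (i : ℕ)).mulVec (vecCoeff 0 y) := by
  simp [cyclicComb, map_sum, vecCoeff_smul, vecCoeff_connection_pow]

/-- `e` generates a free module over `K[Ξ] / Ξ ^ n`: the vectors `Ξ ^ i e`, `i < n`, are
independent. -/
def IsCyclicVec (Ξ : Matrix (Fin n) (Fin n) K) (e : Fin n → K) : Prop :=
  ∀ a : Fin n → K, ∑ i : Fin n, a i • (Ξ ^ (i : ℕ)).mulVec e = 0 → a = 0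

/-- If `y(0)` is cyclic for `Ξ`, then the derivatives `∇ ^ i y`, `i < n`, are independent over the
power series: look at the lowest order terms of a relation. -/
lemma cyclicComb_eq_zero {Ξ : Matrix (Fin n) (Fin n) K} {y g : Fin n → K⟦X⟧}
    (hy : IsCyclicVec Ξ (vecCoeff 0 y)) (h : cyclicComb Ξ y g = 0) : g = 0 := by
  have key : ∀ k, ∀ i, PowerSeries.coeff k (g i) = 0 := by
    intro k
    induction k using Nat.strong_induction_on with
    | _ k ih =>
    have h1 := congrArg (vecCoeff k) h
    have h2 : vecCoeff k (cyclicComb Ξ y g) =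
        ∑ i : Fin n, PowerSeries.coeff k (g i) • (Ξ ^ (i : ℕ)).mulVec (vecCoeff 0 y) := by
      rw [cyclicComb, map_sum]
      refine Finset.sum_congr rfl fun i _ => ?_
      rw [vecCoeff_smul, Finset.sum_eq_single (k, 0)]
      · simp [vecCoeff_connection_pow]
      · rintro ⟨a, b⟩ hab hne
        rw [Finset.HasAntidiagonal.mem_antidiagonal] at hab
        have : a < k := by
          rcases Nat.eq_zero_or_pos b with rfl | hb
          · simp at hab; simp [hab] at hne
          · simp at hab; omega
        simp [ih a this i]
      · simp
    rw [h2, map_zero] at h1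
    exact fun i => congrFun (hy _ h1) i
  ext i k
  simp [key k i]

end Connection

/-! ### Bounded power series and compactness -/

section Bounded

variable {p : ℕ} [Fact p.Prime] {n : ℕ}

/-- The coefficients of `f` are bounded by `B`. -/
def BddBy (B : ℝ) (f : ℚ_[p]⟦X⟧) : Prop := ∀ k, ‖PowerSeries.coeff k f‖ ≤ B

lemma BddBy.mono {B B' : ℝ} {f : ℚ_[p]⟦X⟧} (h : BddBy B f) (hB : B ≤ B') : BddBy B' f :=
  fun k => (h k).trans hB

lemma BddBy.zero {B : ℝ} (hB : 0 ≤ B) : BddBy B (0 : ℚ_[p]⟦X⟧) := fun k => by simpa using hB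

lemma BddBy.one : BddBy 1 (1 : ℚ_[p]⟦X⟧) := fun k => by
  rw [PowerSeries.coeff_one]; split_ifs <;> simp

lemma BddBy.add {B : ℝ} {f g : ℚ_[p]⟦X⟧} (hf : BddBy B f) (hg : BddBy B g) :
    BddBy B (f + g) := fun k => by
  rw [map_add]; exact (IsUltrametricDist.norm_add_le_max _ _).trans (max_le (hf k) (hg k))

lemma BddBy.sum {B : ℝ} (hB : 0 ≤ B) {ι : Type*} {s : Finset ι} {f : ι → ℚ_[p]⟦X⟧}
    (hf : ∀ i ∈ s, BddBy B (f i)) : BddBy B (∑ i ∈ s, f i) := fun k => by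
  rw [map_sum]
  exact IsUltrametricDist.norm_sum_le_of_forall_le_of_nonneg hB fun i hi => hf i hi k

lemma BddBy.mul {B B' : ℝ} (hB : 0 ≤ B) (hB' : 0 ≤ B') {f g : ℚ_[p]⟦X⟧} (hf : BddBy B f)
    (hg : BddBy B' g) : BddBy (B * B') (f * g) := fun k => by
  rw [PowerSeries.coeff_mul]
  refine IsUltrametricDist.norm_sum_le_of_forall_le_of_nonneg (by positivity) fun x _ => ?_
  rw [norm_mul]
  exact mul_le_mul (hf _) (hg _) (norm_nonneg _) hB

lemma BddBy.smul {B B' : ℝ} {c : ℚ_[p]} (hc : ‖c‖ ≤ B') {f : ℚ_[p]⟦X⟧} (hf : BddBy B f) :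
    BddBy (B' * B) (c • f) := fun k => by
  rw [PowerSeries.coeff_smul, smul_eq_mul, norm_mul]
  exact mul_le_mul hc (hf k) (norm_nonneg _) ((norm_nonneg _).trans hc)

lemma BddBy.eulerDeriv {B : ℝ} {f : ℚ_[p]⟦X⟧} (hf : BddBy B f) : BddBy B (eulerDeriv f) :=
  fun k => by
  rw [coeff_eulerDeriv, norm_mul]
  refine (mul_le_of_le_one_left (norm_nonneg _) ?_).trans (hf k)
  exact_mod_cast Padic.norm_int_le_one (p := p) (k : ℤ)

lemma bddBy_map (g : ℤ_[p]⟦X⟧) : BddBy 1 (PowerSeries.map (algebraMap ℤ_[p] ℚ_[p]) g) :=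
  fun k => by
  rw [PowerSeries.coeff_map]; exact PadicInt.norm_le_one _

lemma BddBy.exists_map {f : ℚ_[p]⟦X⟧} (hf : BddBy 1 f) :
    ∃ g : ℤ_[p]⟦X⟧, PowerSeries.map (algebraMap ℤ_[p] ℚ_[p]) g = f := by
  let c : ℕ → ℤ_[p] := fun k => ⟨PowerSeries.coeff k f, hf k⟩
  refine ⟨PowerSeries.mk c, ?_⟩
  ext k
  rw [PowerSeries.coeff_map]
  rw [PowerSeries.coeff_mk]
  rfl

lemma map_algebraMap_injective :
    Function.Injective (PowerSeries.map (algebraMap ℤ_[p] ℚ_[p])) :=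
  PowerSeries.map_injective _ (IsFractionRing.injective ℤ_[p] ℚ_[p])

open Filter in
/-- A bounded box in the span of the `∇ ^ i y` is compact, hence closed for coefficientwise
convergence. -/
lemma exists_cyclicComb_of_tendsto (Ξ : Matrix (Fin n) (Fin n) ℚ_[p]) (y w : Fin n → ℚ_[p]⟦X⟧)
    (B : ℝ) (u : ℕ → Fin n → ℚ_[p]⟦X⟧)
    (hu : ∀ a, ∃ g, (∀ i, BddBy B (g i)) ∧ cyclicComb Ξ y g = u a)
    (hlim : ∀ k, Tendsto (fun a => vecCoeff k (u a)) atTop (nhds (vecCoeff k w))) :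
    ∃ g, (∀ i, BddBy B (g i)) ∧ cyclicComb Ξ y g = w := by
  let S : Set (Fin n → ℕ → ℚ_[p]) :=
    Set.univ.pi fun _ => Set.univ.pi fun _ => Metric.closedBall 0 B
  have hS : IsCompact S :=
    isCompact_univ_pi fun _ => isCompact_univ_pi fun _ => isCompact_closedBall 0 B
  let Ψ : (Fin n → ℕ → ℚ_[p]) → ℕ → Fin n → ℚ_[p] := fun G k =>
    vecCoeff k (cyclicComb Ξ y fun i => PowerSeries.mk (G i))
  have hΨ : Continuous Ψ := by
    refine continuous_pi fun k => ?_
    simp only [Ψ, cyclicComb, map_sum, vecCoeff_smul, PowerSeries.coeff_mk]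
    fun_prop
  have hmem : (fun k => vecCoeff k w) ∈ Ψ '' S := by
    refine (hS.image hΨ).isClosed.mem_of_tendsto
      (tendsto_pi_nhds.2 hlim : Tendsto (fun a k => vecCoeff k (u a)) atTop _)
      (Eventually.of_forall fun a => ?_)
    obtain ⟨g, hg, hgu⟩ := hu a
    refine ⟨fun i k => PowerSeries.coeff k (g i), ?_, ?_⟩
    · simpa [S, Set.mem_pi, BddBy] using hg
    · ext1 k
      simp only [Ψ]
      rw [← hgu]
      congr 2
      ext i k
      simp
  obtain ⟨G, hG, hGw⟩ := hmem
  refine ⟨fun i => PowerSeries.mk (G i), fun i k => ?_, vecCoeff_ext fun k => congrFun hGw k⟩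
  rw [PowerSeries.coeff_mk]
  simpa [S] using hG i (Set.mem_univ _) k (Set.mem_univ _)

end Bounded

/-! ### Lattices spanned by the derivatives of a vector -/

section Lattice

open Polynomial

variable {p : ℕ} [Fact p.Prime] {n : ℕ}

/-- `w` is a combination of the `∇ ^ i y`, `i < n`, whose coefficients have Gauss norm at most
`B`. -/
def InLattice (Ξ : Matrix (Fin n) (Fin n) ℚ_[p]) (y : Fin n → ℚ_[p]⟦X⟧) (B : ℝ)
    (w : Fin n → ℚ_[p]⟦X⟧) : Prop :=
  ∃ g, (∀ i, BddBy B (g i)) ∧ cyclicComb Ξ y g = w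

variable {Ξ : Matrix (Fin n) (Fin n) ℚ_[p]} {y v w : Fin n → ℚ_[p]⟦X⟧} {B B' : ℝ}

lemma InLattice.mono (h : InLattice Ξ y B w) (hB : B ≤ B') : InLattice Ξ y B' w := by
  obtain ⟨g, hg, rfl⟩ := h
  exact ⟨g, fun i => (hg i).mono hB, rfl⟩

lemma InLattice.add (hv : InLattice Ξ y B v) (hw : InLattice Ξ y B w) :
    InLattice Ξ y B (v + w) := by
  obtain ⟨g, hg, rfl⟩ := hv
  obtain ⟨g', hg', rfl⟩ := hw
  exact ⟨g + g', fun i => (hg i).add (hg' i), cyclicComb_add _ _ _ _⟩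

lemma InLattice.sum (hB : 0 ≤ B) {ι : Type*} {s : Finset ι} {w : ι → Fin n → ℚ_[p]⟦X⟧}
    (hw : ∀ i ∈ s, InLattice Ξ y B (w i)) : InLattice Ξ y B (∑ i ∈ s, w i) := by
  refine Finset.sum_induction _ _ (fun _ _ => InLattice.add) ?_ hw
  exact ⟨0, fun _ => BddBy.zero hB, by simp [cyclicComb]⟩

lemma InLattice.smul (hB : 0 ≤ B) (hB' : 0 ≤ B') {f : ℚ_[p]⟦X⟧} (hf : BddBy B' f)
    (hw : InLattice Ξ y B w) : InLattice Ξ y (B' * B) (f • w) := by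
  obtain ⟨g, hg, rfl⟩ := hw
  exact ⟨f • g, fun i => hf.mul hB' hB (hg i), cyclicComb_smul _ _ _ _⟩

lemma InLattice.const_smul {c : ℚ_[p]} (hc : ‖c‖ ≤ B') (hw : InLattice Ξ y B w) :
    InLattice Ξ y (B' * B) (c • w) := by
  obtain ⟨g, hg, rfl⟩ := hw
  exact ⟨c • g, fun i => (hg i).smul hc, cyclicComb_const_smul _ _ _ _⟩

lemma inLattice_connection_pow (i : Fin n) : InLattice Ξ y 1 ((connection Ξ ^ (i : ℕ)) y) := by
  refine ⟨Pi.single i 1, fun j => ?_, cyclicComb_single Ξ y i⟩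
  rcases eq_or_ne j i with rfl | h
  · simpa using BddBy.one
  · simpa [Pi.single_eq_of_ne h] using BddBy.zero zero_le_one

/-- If `∇ ^ n y` is an integral combination of the lower derivatives, the lattice they span is
stable under `∇`. -/
lemma InLattice.map_connection (hy : InLattice Ξ y 1 ((connection Ξ ^ n) y)) (hB : 0 ≤ B)
    (hw : InLattice Ξ y B w) : InLattice Ξ y B (connection Ξ w) := by
  obtain ⟨g, hg, rfl⟩ := hw
  rw [cyclicComb, map_sum]
  refine InLattice.sum hB fun i _ => ?_
  rw [connection_smul]
  refine InLattice.add ?_ ?_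
  · simpa using (inLattice_connection_pow i).smul zero_le_one hB (hg i).eulerDeriv
  · have h1 : InLattice Ξ y 1 (connection Ξ ((connection Ξ ^ (i : ℕ)) y)) := by
      rw [← Module.End.mul_apply, ← pow_succ']
      rcases Nat.lt_or_ge ((i : ℕ) + 1) n with h | h
      · exact inLattice_connection_pow ⟨i + 1, h⟩
      · rwa [show (i : ℕ) + 1 = n by omega]
    simpa using h1.smul zero_le_one hB (hg i)

lemma InLattice.map_connection_pow (hy : InLattice Ξ y 1 ((connection Ξ ^ n) y)) (hB : 0 ≤ B)
    (hw : InLattice Ξ y B w) (m : ℕ) : InLattice Ξ y B ((connection Ξ ^ m) w) := by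
  induction m with
  | zero => simpa using hw
  | succ m ih => rw [pow_succ', Module.End.mul_apply]; exact hy.map_connection hB ih

lemma inLattice_descPochhammer (hn : 0 < n) (hy : InLattice Ξ y 1 ((connection Ξ ^ n) y)) (m : ℕ) :
    InLattice Ξ y 1 (aeval (connection Ξ) (descPochhammer ℚ_[p] m) y) := by
  induction m with
  | zero => simpa using inLattice_connection_pow (Ξ := Ξ) (y := y) ⟨0, hn⟩
  | succ m ih =>
    rw [descPochhammer_succ_right, mul_comm, map_mul, Module.End.mul_apply, map_sub, aeval_X,
      map_natCast, LinearMap.sub_apply, sub_eq_add_neg]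
    refine (hy.map_connection zero_le_one ih).add ?_
    have : -(((m : Module.End ℚ_[p] (Fin n → ℚ_[p]⟦X⟧))) (aeval (connection Ξ) (descPochhammer ℚ_[p] m) y)) =
        (-(m : ℚ_[p])) • (aeval (connection Ξ) (descPochhammer ℚ_[p] m) y) := by
      rw [neg_smul, Module.End.natCast_apply, Nat.cast_smul_eq_nsmul]
    rw [this]
    have h1 : ‖-(m : ℚ_[p])‖ ≤ 1 := by
      rw [norm_neg]; exact_mod_cast Padic.norm_int_le_one (p := p) (m : ℤ)
    simpa using ih.const_smul h1

open Filter in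
/-- If the terms of the Mahler series of `frobeniusChoose p j`, evaluated at `∇` and applied to `y`,
lie in a bounded lattice, so does its limit `w`. -/
lemma inLattice_frobenius (hΞ : Ξ ^ n = 0) (hB : 0 ≤ B) (j : ℕ)
    (h : ∀ i, InLattice Ξ y B
      (aeval (connection Ξ) (C (frobeniusMahler p j i : ℚ_[p]) * binomPoly ℚ_[p] i) y))
    (hw : ∀ k, vecCoeff k w = (aeval (algebraMap ℚ_[p] (Matrix (Fin n) (Fin n) ℚ_[p]) (k : ℚ_[p]) + Ξ)
      (frobeniusLocal p j k)).mulVec (vecCoeff k y)) :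
    InLattice Ξ y B w := by
  refine exists_cyclicComb_of_tendsto Ξ y w B
    (fun a => aeval (connection Ξ) (frobeniusPoly p j (p * j + (p - 1) * a)) y) (fun a => ?_)
    fun k => ?_
  · rw [frobeniusPoly, map_sum, LinearMap.sum_apply]
    exact InLattice.sum hB fun i _ => h i
  · simp only [vecCoeff_aeval, hw, aeval_algebraMap_add hΞ, Matrix.sum_mulVec, Matrix.smul_mulVec]
    exact tendsto_finsetSum _ fun l _ => (tendsto_coeff_frobeniusPoly j k l).smul_const _

/-- A vector `h` whose derivatives lie in the integral lattice of `y` and with `h(0) = y(0)` cyclic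
generates the same lattice: the matrix of the `∇ ^ i h` is the identity at `z = 0`. -/
lemma inLattice_of_vecCoeff_zero_eq {h : Fin n → ℚ_[p]⟦X⟧}
    (hy : IsCyclicVec Ξ (vecCoeff 0 y)) (h0 : vecCoeff 0 h = vecCoeff 0 y)
    (hh : ∀ i : Fin n, InLattice Ξ y 1 ((connection Ξ ^ (i : ℕ)) h))
    (hB : 0 ≤ B) (hw : InLattice Ξ y B w) : InLattice Ξ h B w := by
  choose W hW hWh using hh
  choose V hV using fun i j => (hW i j).exists_map
  let M : Matrix (Fin n) (Fin n) ℤ_[p]⟦X⟧ := Matrix.of V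
  have hconst : M.map PowerSeries.constantCoeff = 1 := by
    ext1 i j
    have h1 := congrArg (vecCoeff 0) (hWh i)
    have hs : vecCoeff 0 ((connection Ξ ^ (i : ℕ)) h) =
        vecCoeff 0 (cyclicComb Ξ y (Pi.single i 1)) := by
      rw [cyclicComb_single, vecCoeff_connection_pow, vecCoeff_connection_pow, h0]
    rw [hs, ← sub_eq_zero, ← map_sub, ← cyclicComb_sub, vecCoeff_zero_cyclicComb] at h1
    have h2 := congrFun (hy _ h1) j
    simp only [Pi.sub_apply, map_sub, Pi.zero_apply, sub_eq_zero] at h2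
    rw [← hV] at h2
    have h3 : algebraMap ℤ_[p] ℚ_[p] (PowerSeries.constantCoeff (V i j)) =
        algebraMap ℤ_[p] ℚ_[p] ((1 : Matrix (Fin n) (Fin n) ℤ_[p]) i j) := by
      rw [← PowerSeries.coeff_zero_eq_constantCoeff_apply, PowerSeries.coeff_map,
        PowerSeries.coeff_zero_eq_constantCoeff_apply] at h2
      rw [h2, Matrix.one_apply]
      rcases eq_or_ne i j with rfl | hij
      · simp
      · simp [hij]
    exact IsFractionRing.injective ℤ_[p] ℚ_[p] h3
  have hdet : IsUnit M.det := by
    rw [PowerSeries.isUnit_iff_constantCoeff, RingHom.map_det, RingHom.mapMatrix_apply, hconst,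
      Matrix.det_one]
    exact isUnit_one
  have hinv := Matrix.nonsing_inv_mul M hdet
  have hyl : ∀ l : Fin n, InLattice Ξ h 1 ((connection Ξ ^ (l : ℕ)) y) := by
    intro l
    refine ⟨fun i => PowerSeries.map (algebraMap ℤ_[p] ℚ_[p]) (M⁻¹ l i), fun i => bddBy_map _, ?_⟩
    rw [← cyclicComb_single, cyclicComb]
    simp only [← hWh, ← cyclicComb_smul, ← cyclicComb_sum]
    congr 1
    ext1 j
    have h1 := congrArg (PowerSeries.map (algebraMap ℤ_[p] ℚ_[p])) (congrFun (congrFun hinv l) j)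
    rw [Matrix.mul_apply, map_sum] at h1
    simp only [map_mul, M, Matrix.of_apply, hV] at h1
    simp only [Finset.sum_apply, Pi.smul_apply, smul_eq_mul, M]
    rw [h1, Matrix.one_apply]
    rcases eq_or_ne l j with rfl | hij
    · simp
    · simp [hij]
  obtain ⟨g, hg, rfl⟩ := hw
  refine InLattice.sum hB fun i _ => ?_
  simpa using (hyl i).smul zero_le_one hB (hg i)

end Lattice

/-! ### The Cartier operator and the substitution `z ↦ z ^ p` -/

section Cartier

open Polynomial

/-- The Cartier operator `∑ f_k z ^ k ↦ ∑ f_{pk} z ^ k`. -/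
def cartier {R : Type*} [CommRing R] (p : ℕ) (f : R⟦X⟧) : R⟦X⟧ :=
  PowerSeries.mk fun k => PowerSeries.coeff (p * k) f

/-- The Cartier operator is linear over the series in `z ^ p`. -/
lemma cartier_mul_expand {R : Type*} [CommRing R] {p : ℕ} (hp : p ≠ 0) (f g : R⟦X⟧) :
    cartier p (f * PowerSeries.expand p hp g) = cartier p f * g := by
  ext k
  rw [cartier, PowerSeries.coeff_mk, PowerSeries.coeff_mul, PowerSeries.coeff_mul]
  symm
  refine Finset.sum_of_injOn (fun x => (p * x.1, p * x.2)) ?_ ?_ ?_ ?_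
  · intro x _ x' _ h
    simp only [Prod.mk.injEq, mul_eq_mul_left_iff, hp, or_false] at h
    exact Prod.ext h.1 h.2
  · intro x hx
    simp only [Finset.mem_coe, Finset.HasAntidiagonal.mem_antidiagonal] at hx ⊢
    rw [← hx]; ring
  · rintro ⟨a, b⟩ hx hx'
    rw [Finset.HasAntidiagonal.mem_antidiagonal] at hx
    rw [PowerSeries.coeff_expand_of_not_dvd, mul_zero]
    rintro ⟨b', rfl⟩
    obtain ⟨a', rfl⟩ : p ∣ a := (Nat.dvd_add_left (Dvd.intro b' rfl)).1 (hx ▸ Dvd.intro k rfl)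
    refine hx' ⟨(a', b'), ?_, rfl⟩
    simp only [Finset.mem_coe, Finset.HasAntidiagonal.mem_antidiagonal]
    simp only [← mul_add] at hx
    exact Nat.eq_of_mul_eq_mul_left (Nat.pos_of_ne_zero hp) hx
  · intro x _
    simp [cartier]

variable {p : ℕ} [Fact p.Prime] {n : ℕ}

lemma BddBy.cartier {B : ℝ} {f : ℚ_[p]⟦X⟧} (hf : BddBy B f) : BddBy B (cartier p f) := fun k => by
  rw [_root_.cartier, PowerSeries.coeff_mk]; exact hf _

/-- The Cartier operator on vectors. -/
def vecCartier (w : Fin n → ℚ_[p]⟦X⟧) : Fin n → ℚ_[p]⟦X⟧ := fun l => cartier p (w l)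

/-- The substitution `z ↦ z ^ p` on vectors. -/
def vecExpand (w : Fin n → ℚ_[p]⟦X⟧) : Fin n → ℚ_[p]⟦X⟧ :=
  fun l => PowerSeries.expand p (Fact.out : p.Prime).ne_zero (w l)

lemma vecCoeff_vecCartier (k : ℕ) (w : Fin n → ℚ_[p]⟦X⟧) :
    vecCoeff k (vecCartier w) = vecCoeff (p * k) w := by
  ext l
  simp [vecCoeff_apply, vecCartier, cartier]

lemma vecCoeff_mul_vecExpand (k : ℕ) (w : Fin n → ℚ_[p]⟦X⟧) :
    vecCoeff (p * k) (vecExpand w) = vecCoeff k w := by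
  ext l
  simp [vecCoeff_apply, vecExpand]

lemma vecCoeff_vecExpand_of_not_dvd {k : ℕ} (hk : ¬ p ∣ k) (w : Fin n → ℚ_[p]⟦X⟧) :
    vecCoeff k (vecExpand w) = 0 := by
  ext l
  simp [vecCoeff_apply, vecExpand, PowerSeries.coeff_expand_of_not_dvd _ _ _ hk]

lemma vecExpand_smul (c : ℚ_[p]) (w : Fin n → ℚ_[p]⟦X⟧) :
    vecExpand (c • w) = c • vecExpand w := by
  ext1 l
  simp [vecExpand]

lemma vecCartier_sum {ι : Type*} (s : Finset ι) (w : ι → Fin n → ℚ_[p]⟦X⟧) :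
    vecCartier (∑ i ∈ s, w i) = ∑ i ∈ s, vecCartier (w i) :=
  vecCoeff_ext fun k => by simp [vecCoeff_vecCartier, map_sum]

lemma vecCartier_smul_vecExpand (f : ℚ_[p]⟦X⟧) (w : Fin n → ℚ_[p]⟦X⟧) :
    vecCartier (f • vecExpand w) = cartier p f • w := by
  ext1 l
  simp only [vecCartier, vecExpand, Pi.smul_apply, smul_eq_mul, cartier_mul_expand]

lemma vecCartier_vecExpand (w : Fin n → ℚ_[p]⟦X⟧) : vecCartier (vecExpand w) = w :=
  vecCoeff_ext fun k => by rw [vecCoeff_vecCartier, vecCoeff_mul_vecExpand]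

lemma natCast_prime_ne_zero : (p : ℚ_[p]) ≠ 0 := by
  exact_mod_cast (Fact.out : p.Prime).ne_zero

/-- With respect to `t = z ^ p` one has `δ_z = p δ_t`, so the exponent matrix gets divided
by `p`. -/
lemma connection_vecExpand (Ξ : Matrix (Fin n) (Fin n) ℚ_[p]) (w : Fin n → ℚ_[p]⟦X⟧) :
    connection Ξ (vecExpand w) = (p : ℚ_[p]) • vecExpand (connection ((p : ℚ_[p])⁻¹ • Ξ) w) := by
  refine vecCoeff_ext fun k => ?_
  rw [vecCoeff_connection, map_smul]
  by_cases hk : p ∣ k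
  · obtain ⟨m, rfl⟩ := hk
    rw [vecCoeff_mul_vecExpand, vecCoeff_mul_vecExpand, vecCoeff_connection, ← Matrix.smul_mulVec]
    congr 1
    rw [smul_add, smul_smul, mul_inv_cancel₀ natCast_prime_ne_zero, one_smul, Nat.cast_mul, map_mul,
      Algebra.smul_def]
  · rw [vecCoeff_vecExpand_of_not_dvd hk, vecCoeff_vecExpand_of_not_dvd hk]
    simp

lemma connection_pow_vecExpand (Ξ : Matrix (Fin n) (Fin n) ℚ_[p]) (w : Fin n → ℚ_[p]⟦X⟧) (m : ℕ) :
    (connection Ξ ^ m) (vecExpand w) =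
      (p : ℚ_[p]) ^ m • vecExpand ((connection ((p : ℚ_[p])⁻¹ • Ξ) ^ m) w) := by
  induction m with
  | zero => simp
  | succ m ih =>
    rw [pow_succ', Module.End.mul_apply, ih, map_smul, connection_vecExpand, smul_smul, ← pow_succ,
      pow_succ' (connection _), Module.End.mul_apply]

/-- Descent from `vecExpand y` to `y`. -/
lemma InLattice.of_vecExpand {Ξ : Matrix (Fin n) (Fin n) ℚ_[p]} {y w : Fin n → ℚ_[p]⟦X⟧} {B : ℝ}
    (h : InLattice Ξ (vecExpand y) B (vecExpand w)) :
    InLattice ((p : ℚ_[p])⁻¹ • Ξ) y B w := by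
  obtain ⟨g, hg, hgw⟩ := h
  refine ⟨fun i => (p : ℚ_[p]) ^ (i : ℕ) • cartier p (g i), fun i => ?_, ?_⟩
  · have h1 : ‖(p : ℚ_[p]) ^ (i : ℕ)‖ ≤ 1 := by
      rw [norm_pow]; exact pow_le_one₀ (norm_nonneg _) (by simpa using Padic.norm_int_le_one (p := p) p)
    simpa using (hg i).cartier.smul h1
  · rw [← vecCartier_vecExpand w, ← hgw, cyclicComb, cyclicComb, vecCartier_sum]
    refine Finset.sum_congr rfl fun i _ => ?_
    rw [connection_pow_vecExpand, ← vecExpand_smul, vecCartier_smul_vecExpand, smul_assoc,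
      smul_comm]

lemma vecCoeff_vecExpand_binomPoly (Ξ : Matrix (Fin n) (Fin n) ℚ_[p]) (y : Fin n → ℚ_[p]⟦X⟧)
    (j k : ℕ) :
    vecCoeff k (vecExpand
      (aeval (connection ((p : ℚ_[p])⁻¹ • Ξ)) (binomPoly ℚ_[p] j) (vecCartier y))) =
      (aeval (algebraMap ℚ_[p] (Matrix (Fin n) (Fin n) ℚ_[p]) (k : ℚ_[p]) + Ξ)
        (frobeniusLocal p j k)).mulVec (vecCoeff k y) := by
  rw [frobeniusLocal]
  split_ifs with hk
  · obtain ⟨m, rfl⟩ := hk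
    rw [vecCoeff_mul_vecExpand, vecCoeff_aeval, vecCoeff_vecCartier, aeval_comp]
    congr 3
    rw [map_mul, aeval_C, aeval_X, ← Algebra.smul_def, smul_add, Nat.cast_mul, map_mul,
      ← Algebra.smul_def, smul_smul, inv_mul_cancel₀ natCast_prime_ne_zero, one_smul]
  · rw [vecCoeff_vecExpand_of_not_dvd hk]; simp

end Cartier

/-! ### Composition of differential operators -/

section Operators

variable {R S : Type*} [CommRing R] [CommRing S]

/-- A differential operator `∑ f i δ ^ i` is encoded by the sequence `f` of its coefficients;
`deltaComp f` is the composite of `δ` with it, `δ ∘ (f i δ ^ i) = δ(f i) δ ^ i + f i δ ^ (i + 1)`. -/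
def deltaComp (f : ℕ → R⟦X⟧) : ℕ → R⟦X⟧
  | 0 => eulerDeriv (f 0)
  | i + 1 => eulerDeriv (f (i + 1)) + f i

lemma deltaComp_iterate_eq_zero {f : ℕ → R⟦X⟧} {d : ℕ} (hf : ∀ i, d < i → f i = 0) (l : ℕ) :
    ∀ i, d + l < i → deltaComp^[l] f i = 0 := by
  induction l with
  | zero => simpa using hf
  | succ l ih =>
    rintro (_ | i) hi
    · omega
    · rw [Function.iterate_succ_apply', deltaComp, ih _ (by omega), ih _ (by omega), eulerDeriv_zero,
        add_zero]

lemma deltaComp_iterate_top {f : ℕ → R⟦X⟧} {d : ℕ} (hf : ∀ i, d < i → f i = 0) (l : ℕ) :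
    deltaComp^[l] f (d + l) = f d := by
  induction l with
  | zero => rfl
  | succ l ih =>
    rw [Function.iterate_succ_apply', ← add_assoc, deltaComp, ih,
      deltaComp_iterate_eq_zero hf l _ (by omega), eulerDeriv_zero, zero_add]

lemma map_deltaComp_iterate (φ : R →+* S) (f : ℕ → R⟦X⟧) (l i : ℕ) :
    PowerSeries.map φ (deltaComp^[l] f i) =
      deltaComp^[l] (fun i => PowerSeries.map φ (f i)) i := by
  induction l generalizing i with
  | zero => rfl
  | succ l ih =>
    rw [Function.iterate_succ_apply', Function.iterate_succ_apply']
    obtain _ | i := i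
    · simp only [deltaComp, map_eulerDeriv, ih]
    · simp only [deltaComp, map_add, map_eulerDeriv, ih]

lemma sum_deltaComp_top {f : ℕ → R⟦X⟧} {d : ℕ} (hf : ∀ i, d < i → f i = 0) (q : ℕ → R⟦X⟧) (m : ℕ) :
    ∑ l ∈ Finset.range (m + 1), q l * deltaComp^[l] f (d + m) = q m * f d := by
  rw [Finset.sum_range_succ, deltaComp_iterate_top hf, Finset.sum_eq_zero, zero_add]
  intro l hl
  rw [deltaComp_iterate_eq_zero hf l _ (by have := Finset.mem_range.mp hl; omega), mul_zero]

/-- Over a domain a nonzero differential operator is not a right zero divisor. -/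
lemma eq_zero_of_sum_deltaComp_eq_zero [IsDomain R] {f : ℕ → R⟦X⟧} {d : ℕ}
    (hf : ∀ i, d < i → f i = 0) (hd : f d ≠ 0) (q : ℕ → R⟦X⟧) (m : ℕ)
    (h : ∀ i, ∑ l ∈ Finset.range m, q l * deltaComp^[l] f i = 0) : ∀ l < m, q l = 0 := by
  induction m with
  | zero => intro l hl; omega
  | succ m ih =>
    have hm : q m = 0 := by
      have h1 := h (d + m)
      rw [sum_deltaComp_top hf] at h1
      exact (mul_eq_zero.mp h1).resolve_right hd
    have h2 := ih fun i => by simpa [Finset.sum_range_succ, hm] using h i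
    intro l hl
    rcases Nat.lt_succ_iff_lt_or_eq.mp hl with h3 | rfl
    exacts [h2 l h3, hm]

end Operators

/-! ### Gauss's lemma for differential operators -/

section Gauss

variable {p : ℕ} [Fact p.Prime]

lemma PowerSeries.exists_eq_prime_mul {g : ℤ_[p]⟦X⟧} (hg : PowerSeries.map PadicInt.toZMod g = 0) :
    ∃ g' : ℤ_[p]⟦X⟧, g = (p : ℤ_[p]⟦X⟧) * g' := by
  have h : ∀ k, ∃ c : ℤ_[p], PowerSeries.coeff k g = p * c := by
    intro k
    have h1 : PowerSeries.coeff k g ∈ RingHom.ker (PadicInt.toZMod (p := p)) := by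
      rw [RingHom.mem_ker, ← PowerSeries.coeff_map, hg, map_zero]
    rw [PadicInt.ker_toZMod, PadicInt.maximalIdeal_eq_span_p, Ideal.mem_span_singleton] at h1
    exact h1
  choose c hc using h
  refine ⟨PowerSeries.mk c, ?_⟩
  ext k
  rw [hc, ← map_natCast (PowerSeries.C (R := ℤ_[p])), PowerSeries.coeff_C_mul,
    PowerSeries.coeff_mk]

lemma natCast_prime_powerSeries_ne_zero : (p : ℤ_[p]⟦X⟧) ≠ 0 := by
  rw [← map_natCast (PowerSeries.C (R := ℤ_[p]))]
  intro h
  have h1 := congrArg PowerSeries.constantCoeff h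
  rw [PowerSeries.constantCoeff_C, map_zero] at h1
  exact (by exact_mod_cast (Fact.out : p.Prime).ne_zero : (p : ℤ_[p]) ≠ 0) h1

lemma map_toZMod_natCast_prime : PowerSeries.map PadicInt.toZMod (p : ℤ_[p]⟦X⟧) = 0 := by
  rw [map_natCast, ← map_natCast (PowerSeries.C (R := ZMod p))]
  simp

/-- The left ideal generated by a primitive operator is saturated with respect to `p`. -/
lemma exists_sum_deltaComp_of_pow_mul {f : ℕ → ℤ_[p]⟦X⟧} {d : ℕ}
    (hf : ∀ i, d < i → f i = 0) (hprim : ∃ i, PowerSeries.map PadicInt.toZMod (f i) ≠ 0)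
    {Q : ℕ → ℤ_[p]⟦X⟧} {m : ℕ} (r : ℕ) : ∀ q : ℕ → ℤ_[p]⟦X⟧,
    (∀ i, (p : ℤ_[p]⟦X⟧) ^ r * Q i = ∑ l ∈ Finset.range m, q l * deltaComp^[l] f i) →
    ∃ q' : ℕ → ℤ_[p]⟦X⟧, ∀ i, Q i = ∑ l ∈ Finset.range m, q' l * deltaComp^[l] f i := by
  classical
  obtain ⟨e, he, hemax⟩ : ∃ e, PowerSeries.map PadicInt.toZMod (f e) ≠ 0 ∧
      ∀ i, e < i → PowerSeries.map PadicInt.toZMod (f i) = 0 := by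
    let P : ℕ → Prop := fun i => PowerSeries.map PadicInt.toZMod (f i) ≠ 0
    obtain ⟨i, hi⟩ := hprim
    have hid : i ≤ d := by
      by_contra hlt
      exact hi (by rw [hf i (by omega), map_zero])
    refine ⟨Nat.findGreatest P d, Nat.findGreatest_spec (P := P) hid hi, fun k hk => ?_⟩
    by_cases hkd : k ≤ d
    · exact not_not.mp (Nat.findGreatest_is_greatest hk hkd)
    · rw [hf k (by omega), map_zero]
  induction r with
  | zero => intro q hq; exact ⟨q, by simpa using hq⟩
  | succ r ih =>
    intro q hq
    have hmod : ∀ l < m, PowerSeries.map PadicInt.toZMod (q l) = 0 := by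
      refine eq_zero_of_sum_deltaComp_eq_zero hemax he _ m fun i => ?_
      have h1 := congrArg (PowerSeries.map PadicInt.toZMod) (hq i)
      rw [map_mul, map_pow, map_toZMod_natCast_prime, zero_pow (Nat.succ_ne_zero r), zero_mul,
        map_sum] at h1
      rw [h1]
      exact Finset.sum_congr rfl fun l _ => by rw [map_mul, map_deltaComp_iterate]
    choose! q' hq' using fun l hl => PowerSeries.exists_eq_prime_mul (hmod l hl)
    refine ih q' fun i => ?_
    refine mul_left_cancel₀ natCast_prime_powerSeries_ne_zero ?_
    rw [← mul_assoc, ← pow_succ', hq, Finset.mul_sum]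
    refine Finset.sum_congr rfl fun l hl => ?_
    rw [← mul_assoc, ← hq' l (Finset.mem_range.mp hl)]

/-- Pseudo-division of differential operators by an operator with constant leading
coefficient `c`. -/
lemma exists_pseudo_division {R : Type*} [CommRing R] {f : ℕ → R⟦X⟧} {n : ℕ} {c : R⟦X⟧}
    (hf : ∀ i, n < i → f i = 0) (hn : f n = c) (d : ℕ) : ∀ Q : ℕ → R⟦X⟧,
    (∀ i, n + d ≤ i → Q i = 0) → ∃ (r : ℕ) (q : ℕ → R⟦X⟧), ∀ i, n ≤ i →
      c ^ r * Q i = ∑ l ∈ Finset.range d, q l * deltaComp^[l] f i := by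
  induction d with
  | zero => intro Q hQ; exact ⟨0, 0, fun i hi => by simp [hQ i hi]⟩
  | succ d ih =>
    intro Q hQ
    obtain ⟨r, q, hq⟩ := ih (fun i => c * Q i - Q (n + d) * deltaComp^[d] f i) fun i hi => by
      rcases hi.eq_or_lt with rfl | hi
      · rw [deltaComp_iterate_top hf, hn]; ring
      · rw [hQ i (by omega), deltaComp_iterate_eq_zero hf _ _ (by omega)]; ring
    refine ⟨r + 1, fun l => if l < d then q l else c ^ r * Q (n + d), fun i hi => ?_⟩
    have h1 : ∑ l ∈ Finset.range d, (if l < d then q l else c ^ r * Q (n + d)) * deltaComp^[l] f i =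
        ∑ l ∈ Finset.range d, q l * deltaComp^[l] f i :=
      Finset.sum_congr rfl fun l hl => by rw [if_pos (Finset.mem_range.mp hl)]
    rw [Finset.sum_range_succ, h1, ← hq i hi]
    simp only [lt_irrefl, ↓reduceIte]
    ring

variable {n : ℕ}

/-- The value `∑ f i ∇ ^ i y`, `i < m`, of an integral differential operator at `y`. -/
def evalOp (Ξ : Matrix (Fin n) (Fin n) ℚ_[p]) (y : Fin n → ℚ_[p]⟦X⟧) (m : ℕ)
    (f : ℕ → ℤ_[p]⟦X⟧) : Fin n → ℚ_[p]⟦X⟧ :=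
  ∑ i ∈ Finset.range m, PowerSeries.map (algebraMap ℤ_[p] ℚ_[p]) (f i) • (connection Ξ ^ i) y

variable {Ξ : Matrix (Fin n) (Fin n) ℚ_[p]} {y : Fin n → ℚ_[p]⟦X⟧}

lemma evalOp_eq_of_le {m m' : ℕ} (h : m ≤ m') {f : ℕ → ℤ_[p]⟦X⟧} (hf : ∀ i, m ≤ i → f i = 0) :
    evalOp Ξ y m' f = evalOp Ξ y m f := by
  symm
  refine Finset.sum_subset (by intro i; simp; omega) fun i _ hi => ?_
  rw [hf i (by simpa using hi)]; simp

lemma evalOp_deltaComp {m : ℕ} {f : ℕ → ℤ_[p]⟦X⟧} (hf : ∀ i, m ≤ i → f i = 0) :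
    evalOp Ξ y (m + 1) (deltaComp f) = connection Ξ (evalOp Ξ y m f) := by
  have h1 : evalOp Ξ y m f = evalOp Ξ y (m + 1) f := (evalOp_eq_of_le (Nat.le_succ m) hf).symm
  have h2 : connection Ξ (evalOp Ξ y m f) =
      ∑ i ∈ Finset.range (m + 1), eulerDeriv (PowerSeries.map (algebraMap ℤ_[p] ℚ_[p]) (f i)) • (connection Ξ ^ i) y +
      ∑ i ∈ Finset.range m, PowerSeries.map (algebraMap ℤ_[p] ℚ_[p]) (f i) • (connection Ξ ^ (i + 1)) y := by
    rw [Finset.sum_range_succ, hf m le_rfl, map_zero, eulerDeriv_zero, zero_smul, add_zero, evalOp,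
      map_sum, ← Finset.sum_add_distrib]
    refine Finset.sum_congr rfl fun i _ => ?_
    rw [connection_smul, pow_succ', Module.End.mul_apply]
  rw [h2, evalOp, Finset.sum_range_succ', Finset.sum_range_succ' (fun i => eulerDeriv _ • _)]
  simp only [deltaComp, map_add, add_smul, Finset.sum_add_distrib, map_eulerDeriv]
  abel

lemma evalOp_deltaComp_iterate {d : ℕ} {f : ℕ → ℤ_[p]⟦X⟧} (hf : ∀ i, d < i → f i = 0) (l : ℕ) :
    evalOp Ξ y (d + 1 + l) (deltaComp^[l] f) = (connection Ξ ^ l) (evalOp Ξ y (d + 1) f) := by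
  induction l with
  | zero => rfl
  | succ l ih =>
    rw [Function.iterate_succ_apply', ← add_assoc, evalOp_deltaComp, ih, pow_succ',
      Module.End.mul_apply]
    intro i hi
    exact deltaComp_iterate_eq_zero hf l i (by omega)

/-- Gauss's lemma for differential operators: if `y` is killed by a monic operator `Q` with integral
coefficients, then the monic operator `δ ^ n - ∑ a i δ ^ i` of order `n` which kills `y` has integral
coefficients too, as soon as they are bounded. -/
lemma bddBy_one_of_monic (hy : IsCyclicVec Ξ (vecCoeff 0 y)) {B : ℝ} {a : Fin n → ℚ_[p]⟦X⟧}
    (ha : ∀ i, BddBy B (a i)) (hay : cyclicComb Ξ y a = (connection Ξ ^ n) y)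
    {Q : ℕ → ℤ_[p]⟦X⟧} {N : ℕ} (hQN : Q N = 1) (hQ : ∀ i, N < i → Q i = 0)
    (hQy : evalOp Ξ y (N + 1) Q = 0) : ∀ i, BddBy 1 (a i) := by
  classical
  have hpn : ‖(p : ℚ_[p])‖ = (p : ℝ)⁻¹ := Padic.norm_p
  have hp0 : (0 : ℝ) < p := by exact_mod_cast (Fact.out : p.Prime).pos
  -- the least power of `p` which clears the denominators
  have hex : ∃ s : ℕ, ∀ i, BddBy 1 ((p : ℚ_[p]) ^ s • a i) := by
    obtain ⟨s, hs⟩ := pow_unbounded_of_one_lt B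
      (by exact_mod_cast (Fact.out : p.Prime).one_lt : (1 : ℝ) < p)
    refine ⟨s, fun i k => ?_⟩
    rw [PowerSeries.coeff_smul, smul_eq_mul, norm_mul, norm_pow, hpn, inv_pow,
      inv_mul_le_iff₀ (by positivity), mul_one]
    exact (ha i k).trans hs.le
  obtain ⟨s, hs, hmin⟩ : ∃ s : ℕ, (∀ i, BddBy 1 ((p : ℚ_[p]) ^ s • a i)) ∧
      ∀ r < s, ¬ ∀ i, BddBy 1 ((p : ℚ_[p]) ^ r • a i) :=
    ⟨Nat.find hex, Nat.find_spec hex, fun r hr => Nat.find_min hex hr⟩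
  obtain _ | s := s
  · simpa using hs
  exfalso
  choose b hb using fun i => (hs i).exists_map
  let f : ℕ → ℤ_[p]⟦X⟧ := fun i =>
    if h : i < n then - b ⟨i, h⟩ else if i = n then (p : ℤ_[p]⟦X⟧) ^ (s + 1) else 0
  have hfn : f n = (p : ℤ_[p]⟦X⟧) ^ (s + 1) := by simp [f]
  have hf0 : ∀ i, n < i → f i = 0 := fun i hi => by
    simp only [f]; rw [dif_neg (by omega), if_neg (by omega)]
  have hfi : ∀ i : Fin n, f i = - b i := fun i => by simp [f]
  have hprim : ∃ i, PowerSeries.map PadicInt.toZMod (f i) ≠ 0 := by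
    by_contra! hcon
    refine hmin s (Nat.lt_succ_self s) fun i => ?_
    obtain ⟨g, hg⟩ := PowerSeries.exists_eq_prime_mul (hcon i)
    have h1 : PowerSeries.map (algebraMap ℤ_[p] ℚ_[p]) (p * g) = - ((p : ℚ_[p]) ^ (s + 1) • a i) := by rw [← hg, hfi, map_neg, hb]
    have h2 : (p : ℚ_[p]) ^ s • a i = PowerSeries.map (algebraMap ℤ_[p] ℚ_[p]) (-g) := by
      ext k
      have h3 := congrArg (PowerSeries.coeff k) h1
      rw [← map_natCast (PowerSeries.C (R := ℤ_[p])), map_mul, PowerSeries.map_C,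
        PowerSeries.coeff_C_mul, map_natCast, map_neg, PowerSeries.coeff_smul, smul_eq_mul] at h3
      rw [map_neg, map_neg, PowerSeries.coeff_smul, smul_eq_mul]
      refine mul_left_cancel₀ (natCast_prime_ne_zero (p := p)) ?_
      rw [mul_neg, h3]; ring
    rw [h2]
    exact bddBy_map _
  have hfy : evalOp Ξ y (n + 1) f = 0 := by
    rw [evalOp, Finset.sum_range_succ, hfn, ← hay, cyclicComb, Finset.sum_range, Finset.smul_sum,
      ← Finset.sum_add_distrib]
    refine Finset.sum_eq_zero fun i _ => ?_
    have h0 : PowerSeries.map (algebraMap ℤ_[p] ℚ_[p]) ((p : ℤ_[p]⟦X⟧) ^ (s + 1)) * a i + -((p : ℚ_[p]) ^ (s + 1) • a i) = 0 := by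
      rw [map_pow, map_natCast, PowerSeries.smul_eq_C_mul, map_pow, map_natCast]
      ring
    rw [hfi, map_neg, hb, smul_smul, ← add_smul, add_comm, h0, zero_smul]
  obtain ⟨r, q, hq⟩ := exists_pseudo_division hf0 hfn (N + 1) Q fun i hi => hQ i (by omega)
  have hdiv : ∀ i, (p : ℤ_[p]⟦X⟧) ^ ((s + 1) * r) * Q i =
      ∑ l ∈ Finset.range (N + 1), q l * deltaComp^[l] f i := by
    -- the remainder kills `y` and has order less than `n`
    set rem : ℕ → ℤ_[p]⟦X⟧ := fun i => ((p : ℤ_[p]⟦X⟧) ^ (s + 1)) ^ r * Q i -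
      ∑ l ∈ Finset.range (N + 1), q l * deltaComp^[l] f i with hrem
    have h0 : ∀ i, n ≤ i → rem i = 0 := fun i hi => sub_eq_zero.2 (hq i hi)
    have hev : evalOp Ξ y (n + 1 + (N + 1)) rem = 0 := by
      have h1 : evalOp Ξ y (n + 1 + (N + 1)) rem =
          PowerSeries.map (algebraMap ℤ_[p] ℚ_[p]) (((p : ℤ_[p]⟦X⟧) ^ (s + 1)) ^ r) • evalOp Ξ y (n + 1 + (N + 1)) Q -
          ∑ l ∈ Finset.range (N + 1), PowerSeries.map (algebraMap ℤ_[p] ℚ_[p]) (q l) • evalOp Ξ y (n + 1 + (N + 1)) (deltaComp^[l] f) := by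
        simp only [evalOp, Finset.smul_sum, hrem]
        rw [Finset.sum_comm, ← Finset.sum_sub_distrib]
        refine Finset.sum_congr rfl fun i _ => ?_
        simp only [map_sub, map_sum, map_mul, sub_smul, Finset.sum_smul, smul_smul]
      rw [h1, evalOp_eq_of_le (by omega) (fun i hi => hQ i hi : ∀ i, N + 1 ≤ i → Q i = 0), hQy,
        smul_zero, zero_sub, neg_eq_zero]
      refine Finset.sum_eq_zero fun l hl => ?_
      have hl' := Finset.mem_range.mp hl
      rw [evalOp_eq_of_le (m := n + 1 + l) (by omega)
        (fun i hi => deltaComp_iterate_eq_zero hf0 l i (by omega)), evalOp_deltaComp_iterate hf0,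
        hfy, map_zero, smul_zero]
    rw [evalOp_eq_of_le (m := n) (by omega) h0, evalOp, Finset.sum_range] at hev
    have hzero := cyclicComb_eq_zero (g := fun i : Fin n => PowerSeries.map (algebraMap ℤ_[p] ℚ_[p]) (rem i)) hy hev
    intro i
    rw [pow_mul, ← sub_eq_zero]
    change rem i = 0
    rcases Nat.lt_or_ge i n with hi | hi
    · refine map_algebraMap_injective ?_
      rw [map_zero]
      exact congrFun hzero ⟨i, hi⟩
    · exact h0 i hi
  obtain ⟨q', hq'⟩ := exists_sum_deltaComp_of_pow_mul hf0 hprim _ q hdiv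
  -- compare the leading coefficients: `1` would be divisible by `p`
  have hcontra : ∀ m, (∀ i, Q i = ∑ l ∈ Finset.range m, q' l * deltaComp^[l] f i) → False := by
    intro m
    induction m with
    | zero => intro h; have := h N; simp [hQN] at this
    | succ m ih =>
      intro h
      have htop := h (n + m)
      rw [sum_deltaComp_top hf0, hfn] at htop
      by_cases hqm : q' m = 0
      · exact ih fun i => by rw [h i, Finset.sum_range_succ, hqm, zero_mul, add_zero]
      · have hne : Q (n + m) ≠ 0 := by
          rw [htop]
          exact mul_ne_zero hqm (pow_ne_zero _ natCast_prime_powerSeries_ne_zero)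
        have hle : n + m ≤ N := by
          by_contra hlt
          exact hne (hQ _ (by omega))
        rcases hle.eq_or_lt with heq | hlt
        · rw [heq, hQN] at htop
          have := congrArg (PowerSeries.map (PadicInt.toZMod (p := p))) htop
          rw [map_one, map_mul, map_pow, map_toZMod_natCast_prime, zero_pow (Nat.succ_ne_zero s),
            mul_zero] at this
          exact one_ne_zero this
        · have h1 := h N
          rw [hQN, Finset.sum_eq_zero] at h1
          · exact one_ne_zero h1
          · intro l hl
            have := Finset.mem_range.mp hl
            rw [deltaComp_iterate_eq_zero hf0 l _ (by omega), mul_zero]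
  exact hcontra _ hq'

end Gauss

/-! ### The Frobenius antecedent -/

section Descent

open Polynomial

variable {p : ℕ} [Fact p.Prime] {n : ℕ}

/-- A bounded sequence of vectors of power series satisfies a monic integral relation, because
`ℤ_p⟦z⟧` is Noetherian. -/
lemma exists_eq_sum_of_bddBy {B : ℝ} {r : ℕ → Fin n → ℚ_[p]⟦X⟧} (hr : ∀ j i, BddBy B (r j i)) :
    ∃ (N : ℕ) (o : Fin N → ℤ_[p]⟦X⟧),
      r N = ∑ j : Fin N, PowerSeries.map (algebraMap ℤ_[p] ℚ_[p]) (o j) • r j := by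
  have hp0 : (0 : ℝ) < p := by exact_mod_cast (Fact.out : p.Prime).pos
  obtain ⟨s, hs⟩ := pow_unbounded_of_one_lt B
    (by exact_mod_cast (Fact.out : p.Prime).one_lt : (1 : ℝ) < p)
  have hint : ∀ j i, BddBy 1 ((p : ℚ_[p]) ^ s • r j i) := fun j i k => by
    rw [PowerSeries.coeff_smul, smul_eq_mul, norm_mul, norm_pow, Padic.norm_p, inv_pow,
      inv_mul_le_iff₀ (by positivity), mul_one]
    exact (hr j i k).trans hs.le
  choose g hg using fun j i => (hint j i).exists_map
  let S : ℕ →o Submodule ℤ_[p]⟦X⟧ (Fin n → ℤ_[p]⟦X⟧) :=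
    ⟨fun N => Submodule.span _ (Set.range fun j : Fin N => g j), fun N N' h =>
      Submodule.span_mono (by rintro _ ⟨j, rfl⟩; exact ⟨Fin.castLE h j, rfl⟩)⟩
  obtain ⟨N, hN⟩ := monotone_stabilizes_iff_noetherian.2
    (inferInstance : IsNoetherian ℤ_[p]⟦X⟧ (Fin n → ℤ_[p]⟦X⟧)) S
  have hmem : g N ∈ S N := by
    rw [hN (N + 1) (Nat.le_succ N)]
    exact Submodule.subset_span ⟨Fin.last N, by simp⟩
  obtain ⟨o, ho⟩ := (Submodule.mem_span_range_iff_exists_fun _).1 hmem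
  refine ⟨N, o, ?_⟩
  ext1 i
  have h1 := congrArg (PowerSeries.map (algebraMap ℤ_[p] ℚ_[p])) (congrFun ho i)
  simp only [Finset.sum_apply, Pi.smul_apply, smul_eq_mul, map_sum, map_mul, hg,
    mul_smul_comm, ← Finset.smul_sum] at h1
  simp only [Finset.sum_apply, Pi.smul_apply, smul_eq_mul]
  exact (smul_right_injective _ (pow_ne_zero s natCast_prime_ne_zero) h1).symm

lemma Padic.norm_natCast_le_of_dvd {m : ℕ} {a : ℕ} (h : p ^ a ∣ m) :
    ‖(m : ℚ_[p])‖ ≤ ((p : ℝ)⁻¹) ^ a := by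
  have := (Padic.norm_int_le_pow_iff_dvd (p := p) (m : ℤ) a).2 (by exact_mod_cast h)
  simpa [zpow_neg, inv_pow] using this

lemma Padic.norm_natCast_le_one (m : ℕ) : ‖(m : ℚ_[p])‖ ≤ 1 := by
  simpa using Padic.norm_natCast_le_of_dvd (p := p) (m := m) (a := 0) (by simp)

lemma pow_div_dvd_factorial {p : ℕ} (hp : 0 < p) (j : ℕ) : p ^ (j / p) ∣ j.factorial := by
  have h : ∀ m, p ^ m ∣ (p * m).factorial := by
    intro m
    induction m with
    | zero => simp
    | succ m ih =>
      have h1 : (p * m).factorial * (p * (m + 1)) ∣ (p * (m + 1)).factorial := by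
        have h2 : (p * (m + 1)) ≠ 0 := by positivity
        rw [← Nat.mul_factorial_pred h2, mul_comm]
        exact mul_dvd_mul_left _ (Nat.factorial_dvd_factorial (by
          have : p * (m + 1) = p * m + p := by ring
          omega))
      rw [pow_succ]
      exact (mul_dvd_mul ih (Dvd.intro _ rfl)).trans h1
  exact (h _).trans (Nat.factorial_dvd_factorial (Nat.mul_div_le j p))

/-- Under `z ↦ z ^ p` growth rates get raised to the power `p`; the bound by `p` keeps them below the
decay of the Mahler coefficients. -/
lemma exists_root_pow_le (p : ℕ) [Fact p.Prime] {ρ : ℝ} (hρ : 1 < ρ) :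
    ∃ σ : ℝ, 1 < σ ∧ σ ^ p ≤ ρ ∧ σ ^ p ≤ p := by
  have hp := (Fact.out : p.Prime)
  have hp0 : (p : ℝ) ≠ 0 := by exact_mod_cast hp.ne_zero
  have hm : 1 < min ρ 2 := lt_min hρ one_lt_two
  refine ⟨min ρ 2 ^ (1 / (p : ℝ)), Real.one_lt_rpow hm (by positivity), ?_, ?_⟩ <;>
    rw [← Real.rpow_natCast, ← Real.rpow_mul (by positivity), one_div, inv_mul_cancel₀ hp0,
      Real.rpow_one]
  · exact min_le_left _ _
  · exact (min_le_right _ _).trans (by exact_mod_cast hp.two_le)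

/-- The coordinates of `∇ (∇ - 1) ⋯ (∇ - j + 1) y / j!` with respect to the `∇ ^ i y`, `i < n`, grow
subexponentially in `j`. For the cyclic vector of a differential operator this says that the generic
radius of convergence is at least one. -/
def HasSubexpGrowth (Ξ : Matrix (Fin n) (Fin n) ℚ_[p]) (y : Fin n → ℚ_[p]⟦X⟧) : Prop :=
  ∀ ρ : ℝ, 1 < ρ → ∃ C : ℝ, 0 ≤ C ∧
    ∀ j, InLattice Ξ y (C * ρ ^ j) (aeval (connection Ξ) (binomPoly ℚ_[p] j) y)

variable {Ξ : Matrix (Fin n) (Fin n) ℚ_[p]} {y : Fin n → ℚ_[p]⟦X⟧}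

lemma aeval_descPochhammer_eq_sum {j M : ℕ} (h : j < M) :
    aeval (connection Ξ) (descPochhammer ℚ_[p] j) y =
      ∑ i ∈ Finset.range M,
        ((descPochhammer ℤ j).coeff i : ℚ_[p]) • (connection Ξ ^ i) y := by
  rw [aeval_eq_sum_range' (n := M) (by rwa [descPochhammer_natDegree]), LinearMap.sum_apply]
  refine Finset.sum_congr rfl fun i _ => ?_
  rw [← descPochhammer_map (Int.castRingHom ℚ_[p]), coeff_map]
  simp

/-- If `∇ ^ n y` has bounded coordinates and the growth is subexponential, the coordinates are
integral: the vectors `∇ (∇ - 1) ⋯ (∇ - j + 1) y` stay bounded, so that `y` is killed by a monic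
operator with integral coefficients. -/
lemma inLattice_one_of_growth (hy : IsCyclicVec Ξ (vecCoeff 0 y)) (hgr : HasSubexpGrowth Ξ y)
    {B : ℝ} (hB : InLattice Ξ y B ((connection Ξ ^ n) y)) :
    InLattice Ξ y 1 ((connection Ξ ^ n) y) := by
  obtain ⟨σ, hσ, -, hσp⟩ := exists_root_pow_le p one_lt_two
  obtain ⟨C, hC, hgr⟩ := hgr σ hσ
  have hp := (Fact.out : p.Prime)
  have hp0 : (0 : ℝ) < p := by exact_mod_cast hp.pos
  have hdesc : ∀ j, InLattice Ξ y (C * p) (aeval (connection Ξ) (descPochhammer ℚ_[p] j) y) := by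
    intro j
    have hj : (j.factorial : ℚ_[p]) ≠ 0 := by exact_mod_cast j.factorial_ne_zero
    have h1 : descPochhammer ℚ_[p] j = Polynomial.C (j.factorial : ℚ_[p]) * binomPoly ℚ_[p] j := by
      rw [binomPoly, ← mul_assoc, ← C_mul, mul_inv_cancel₀ hj, C_1, one_mul]
    have h2 := (hgr j).const_smul
      (Padic.norm_natCast_le_of_dvd (p := p) (pow_div_dvd_factorial hp.pos j))
    rw [h1, map_mul, aeval_C, Module.End.mul_apply, Module.algebraMap_end_apply]
    refine h2.mono ?_
    have h3 : σ ^ j ≤ (p : ℝ) ^ (j / p + 1) := by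
      calc σ ^ j ≤ σ ^ (p * (j / p + 1)) :=
            pow_le_pow_right₀ hσ.le (Nat.lt_mul_div_succ j hp.pos).le
        _ = (σ ^ p) ^ (j / p + 1) := pow_mul _ _ _
        _ ≤ _ := by gcongr
    calc ((p : ℝ)⁻¹) ^ (j / p) * (C * σ ^ j) ≤ ((p : ℝ)⁻¹) ^ (j / p) * (C * (p : ℝ) ^ (j / p + 1)) := by
          gcongr
      _ = C * p := by rw [inv_pow, pow_succ]; field_simp
  choose r hr hry using hdesc
  obtain ⟨N, o, ho⟩ := exists_eq_sum_of_bddBy hr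
  obtain ⟨a, ha, hay⟩ := hB
  refine ⟨a, ?_, hay⟩
  let Q : ℕ → ℤ_[p]⟦X⟧ := fun i => ((descPochhammer ℤ N).coeff i : ℤ_[p]⟦X⟧) -
    ∑ j : Fin N, o j * ((descPochhammer ℤ j).coeff i : ℤ_[p]⟦X⟧)
  have hsmall : ∀ j i, j < i → (descPochhammer ℤ j).coeff i = 0 := fun j i hi =>
    coeff_eq_zero_of_natDegree_lt (by rwa [descPochhammer_natDegree])
  refine bddBy_one_of_monic hy ha hay (Q := Q) (N := N) ?_ (fun i hi => ?_) ?_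
  · have h1 : (descPochhammer ℤ N).coeff N = 1 := by
      have := (monic_descPochhammer ℤ N).coeff_natDegree
      rwa [descPochhammer_natDegree] at this
    simp only [Q, h1]
    rw [Finset.sum_eq_zero fun j _ => by rw [hsmall j N j.2]; simp]
    simp
  · simp only [Q, hsmall N i hi]
    rw [Finset.sum_eq_zero fun j _ => by rw [hsmall j i (j.2.trans hi)]; simp]
    simp
  · have h1 : evalOp Ξ y (N + 1) Q = aeval (connection Ξ) (descPochhammer ℚ_[p] N) y -
        ∑ j : Fin N, PowerSeries.map (algebraMap ℤ_[p] ℚ_[p]) (o j) •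
          aeval (connection Ξ) (descPochhammer ℚ_[p] j) y := by
      rw [aeval_descPochhammer_eq_sum (Nat.lt_succ_self N)]
      rw [Finset.sum_congr rfl fun (j : Fin N) _ => by
        rw [aeval_descPochhammer_eq_sum (j.2.trans (Nat.lt_succ_self N))]]
      simp only [Finset.smul_sum]
      rw [Finset.sum_comm, ← Finset.sum_sub_distrib, evalOp]
      refine Finset.sum_congr rfl fun i _ => ?_
      have hcast : ∀ (c : ℤ) (w : Fin n → ℚ_[p]⟦X⟧), (c : ℚ_[p]) • w = (c : ℚ_[p]⟦X⟧) • w := by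
        intro c w
        rw [Int.cast_smul_eq_zsmul, Int.cast_smul_eq_zsmul]
      simp only [Q, map_sub, map_sum, map_mul, map_intCast, sub_smul, Finset.sum_smul, hcast,
        smul_smul]
    rw [h1, ← hry, ho, cyclicComb_sum]
    simp only [cyclicComb_smul, hry, sub_self]

lemma norm_frobeniusMahler_mul_pow_le {σ : ℝ} (h1 : 1 ≤ σ) (hσ : σ ^ p ≤ p) (i j : ℕ) :
    ‖(frobeniusMahler p j i : ℚ_[p])‖ * σ ^ i ≤ p * σ ^ (p * j) := by
  have hp := (Fact.out : p.Prime)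
  have hp1 : (1 : ℝ) ≤ p := by exact_mod_cast hp.one_le
  rcases Nat.lt_or_ge (p * j) i with hi | hi
  · set a := (i - p * j - 1) / (p - 1) with ha
    have hp2 := hp.two_le
    have h2 : (p - 1) * a ≤ i - p * j - 1 := Nat.mul_div_le _ _
    have h3 : i - p * j - 1 < (p - 1) * (a + 1) := Nat.lt_mul_div_succ _ (by omega)
    have h4 : (p - 1) * (a + 1) ≤ p * (a + 1) := Nat.mul_le_mul_right _ (Nat.sub_le _ _)
    have h5 : ‖(frobeniusMahler p j i : ℚ_[p])‖ ≤ ((p : ℝ)⁻¹) ^ a :=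
      Padic.norm_frobeniusMahler_le (by omega)
    have h6 : σ ^ i ≤ σ ^ (p * j) * (p : ℝ) ^ (a + 1) := by
      calc σ ^ i ≤ σ ^ (p * j + p * (a + 1)) := pow_le_pow_right₀ h1 (by omega)
        _ = σ ^ (p * j) * (σ ^ p) ^ (a + 1) := by rw [pow_add, pow_mul σ p (a + 1)]
        _ ≤ _ := by gcongr
    calc _ ≤ ((p : ℝ)⁻¹) ^ a * (σ ^ (p * j) * (p : ℝ) ^ (a + 1)) := by gcongr
      _ = p * σ ^ (p * j) := by rw [inv_pow, pow_succ]; field_simp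
  · have h5 : ‖(frobeniusMahler p j i : ℚ_[p])‖ ≤ 1 := Padic.norm_int_le_one _
    calc _ ≤ 1 * σ ^ (p * j) := by gcongr
      _ ≤ _ := by gcongr

/-- The divisibility of the Mahler coefficients of the indicator function of `p ℤ` beats the
denominators of the binomial polynomials (Legendre's formula). -/
lemma norm_frobeniusMahler_zero_le (i : ℕ) :
    ‖(frobeniusMahler p 0 i : ℚ_[p]) * (i.factorial : ℚ_[p])⁻¹‖ ≤ 1 := by
  have hp := (Fact.out : p.Prime)
  have hp0 : (0 : ℝ) < p := by exact_mod_cast hp.pos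
  rcases Nat.eq_zero_or_pos i with rfl | hi
  · simpa using Padic.norm_int_le_one (p := p) (frobeniusMahler p 0 0)
  · have h1 := sub_one_mul_padicValNat_factorial_lt_of_ne_zero p hi.ne'
    have h2 : ‖(frobeniusMahler p 0 i : ℚ_[p])‖ ≤ ((p : ℝ)⁻¹) ^ padicValNat p i.factorial :=
      Padic.norm_frobeniusMahler_le (by omega)
    have h3 : ‖(i.factorial : ℚ_[p])‖ = ((p : ℝ)⁻¹) ^ padicValNat p i.factorial := by
      rw [Padic.norm_eq_zpow_neg_valuation (by exact_mod_cast i.factorial_ne_zero),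
        Padic.valuation_natCast, zpow_neg, zpow_natCast, inv_pow]
    rw [norm_mul, norm_inv, h3, ← div_eq_mul_inv]
    exact div_le_one_of_le₀ h2 (by positivity)

/-- `y` is the cyclic vector of a differential operator with integral coefficients, with
nilpotent exponent matrix `Ξ` and generic radius of convergence at least one. -/
structure IsGoodCyclic (Ξ : Matrix (Fin n) (Fin n) ℚ_[p]) (y : Fin n → ℚ_[p]⟦X⟧) : Prop where
  nilpotent : Ξ ^ n = 0
  cyclic : IsCyclicVec Ξ (vecCoeff 0 y)
  integral : InLattice Ξ y 1 ((connection Ξ ^ n) y)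
  growth : HasSubexpGrowth Ξ y

lemma IsCyclicVec.smul {e : Fin n → ℚ_[p]} (h : IsCyclicVec Ξ e) {c : ℚ_[p]} (hc : c ≠ 0) :
    IsCyclicVec (c • Ξ) e := by
  intro a ha
  have h1 := h (fun i => a i * c ^ (i : ℕ)) (by
    simpa only [_root_.smul_pow, Matrix.smul_mulVec, smul_smul] using ha)
  ext i
  exact (mul_eq_zero.mp (congrFun h1 i)).resolve_right (pow_ne_zero _ hc)

lemma binomPoly_zero (K : Type*) [Field K] : binomPoly K 0 = 1 := by simp [binomPoly]

/-- The part of `y` in exponents divisible by `p` lies in the integral lattice of `y`. -/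
lemma IsGoodCyclic.inLattice_vecExpand_vecCartier (hn : 0 < n) (h : IsGoodCyclic Ξ y) :
    InLattice Ξ y 1 (vecExpand (vecCartier y)) := by
  refine inLattice_frobenius h.nilpotent zero_le_one 0 (fun i => ?_) fun k => ?_
  · have h1 : C (frobeniusMahler p 0 i : ℚ_[p]) * binomPoly ℚ_[p] i =
        C ((frobeniusMahler p 0 i : ℚ_[p]) * (i.factorial : ℚ_[p])⁻¹) *
          descPochhammer ℚ_[p] i := by
      rw [binomPoly, C_mul, mul_assoc]
    rw [h1, map_mul, aeval_C, Module.End.mul_apply, Module.algebraMap_end_apply]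
    simpa using (inLattice_descPochhammer hn h.integral i).const_smul
      (norm_frobeniusMahler_zero_le i)
  · rw [← vecCoeff_vecExpand_binomPoly, binomPoly_zero, map_one, Module.End.one_apply]

/-- The part of `y` in exponents divisible by `p` generates the lattice of `y`. -/
lemma IsGoodCyclic.inLattice_vecExpand (hn : 0 < n) (h : IsGoodCyclic Ξ y) {B : ℝ} (hB : 0 ≤ B)
    {w : Fin n → ℚ_[p]⟦X⟧} (hw : InLattice Ξ y B w) :
    InLattice Ξ (vecExpand (vecCartier y)) B w := by
  refine inLattice_of_vecCoeff_zero_eq h.cyclic ?_ (fun i =>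
    h.integral.map_connection_pow zero_le_one (h.inLattice_vecExpand_vecCartier hn) i) hB hw
  rw [← mul_zero p, vecCoeff_mul_vecExpand, vecCoeff_vecCartier]

/-- The Frobenius antecedent: the hypotheses on `y` pass to the series of its coefficients with index
divisible by `p`, with exponents divided by `p`. -/
lemma IsGoodCyclic.antecedent (hn : 0 < n) (h : IsGoodCyclic Ξ y) :
    IsGoodCyclic ((p : ℚ_[p])⁻¹ • Ξ) (vecCartier y) := by
  have hpK : (p : ℚ_[p]) ≠ 0 := natCast_prime_ne_zero
  have hcyc : IsCyclicVec ((p : ℚ_[p])⁻¹ • Ξ) (vecCoeff 0 (vecCartier y)) := by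
    rw [vecCoeff_vecCartier, mul_zero]
    exact h.cyclic.smul (inv_ne_zero hpK)
  have hgr : HasSubexpGrowth ((p : ℚ_[p])⁻¹ • Ξ) (vecCartier y) := by
    intro ρ hρ
    obtain ⟨σ, hσ, hσρ, hσp⟩ := exists_root_pow_le p hρ
    obtain ⟨C, hC, hgr⟩ := h.growth σ hσ
    refine ⟨p * C, by positivity, fun j => InLattice.of_vecExpand ?_⟩
    refine h.inLattice_vecExpand hn (by positivity) ?_
    refine inLattice_frobenius h.nilpotent (by positivity) j (fun i => ?_)
      fun k => vecCoeff_vecExpand_binomPoly Ξ y j k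
    rw [map_mul, aeval_C, Module.End.mul_apply, Module.algebraMap_end_apply]
    refine ((hgr i).const_smul le_rfl).mono ?_
    calc _ = C * (‖(frobeniusMahler p j i : ℚ_[p])‖ * σ ^ i) := by ring
      _ ≤ C * (p * σ ^ (p * j)) :=
          mul_le_mul_of_nonneg_left (norm_frobeniusMahler_mul_pow_le hσ.le hσp i j) hC
      _ = p * C * (σ ^ p) ^ j := by rw [pow_mul]; ring
      _ ≤ _ := by gcongr
  refine ⟨by rw [_root_.smul_pow, h.nilpotent, smul_zero], hcyc, ?_, hgr⟩
  refine inLattice_one_of_growth hcyc hgr (B := ‖((p : ℚ_[p]) ^ n)⁻¹‖ * 1)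
    (InLattice.of_vecExpand ?_)
  have h1 : vecExpand ((connection ((p : ℚ_[p])⁻¹ • Ξ) ^ n) (vecCartier y)) =
      ((p : ℚ_[p]) ^ n)⁻¹ • (connection Ξ ^ n) (vecExpand (vecCartier y)) := by
    rw [connection_pow_vecExpand, smul_smul, inv_mul_cancel₀ (pow_ne_zero n hpK), one_smul]
  rw [h1]
  refine InLattice.const_smul le_rfl (h.inLattice_vecExpand hn zero_le_one ?_)
  exact h.integral.map_connection_pow zero_le_one (h.inLattice_vecExpand_vecCartier hn) n

lemma vecMul_pow_algebraMap_add {v : Fin n → ℚ_[p]} (hv : Matrix.vecMul v Ξ = 0) (c : ℚ_[p])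
    (m : ℕ) : Matrix.vecMul v ((algebraMap ℚ_[p] (Matrix (Fin n) (Fin n) ℚ_[p]) c + Ξ) ^ m) =
      c ^ m • v := by
  induction m with
  | zero => simp
  | succ m ih =>
    rw [pow_succ, ← Matrix.vecMul_vecMul, ih, Matrix.smul_vecMul, Matrix.vecMul_add, hv, add_zero,
      Algebra.algebraMap_eq_smul_one, Matrix.vecMul_smul, Matrix.vecMul_one, smul_smul, ← pow_succ]

/-- A linear form `v` with `v Ξ = 0` turns `y` into an honest power series solution; its coefficients
are integral. The coefficient of index `k` is expressed through the coefficients of index at most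
`k / p` of the Frobenius antecedent. -/
theorem IsGoodCyclic.norm_dotProduct_le_one (hn : 0 < n) (k : ℕ) :
    ∀ {Ξ : Matrix (Fin n) (Fin n) ℚ_[p]} {y : Fin n → ℚ_[p]⟦X⟧}, IsGoodCyclic Ξ y →
      ∀ {v : Fin n → ℚ_[p]}, Matrix.vecMul v Ξ = 0 → ‖v ⬝ᵥ vecCoeff 0 y‖ ≤ 1 →
        ‖v ⬝ᵥ vecCoeff k y‖ ≤ 1 := by
  induction k using Nat.strong_induction_on with
  | _ k ih =>
  intro Ξ y h v hv h0
  rcases Nat.eq_zero_or_pos k with rfl | hk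
  · exact h0
  have hp := (Fact.out : p.Prime)
  have hself : InLattice Ξ y 1 y := by simpa using inLattice_connection_pow (Ξ := Ξ) (y := y) ⟨0, hn⟩
  obtain ⟨g, hg, hgy⟩ := h.inLattice_vecExpand hn zero_le_one hself
  rw [← hgy, cyclicComb, map_sum, dotProduct_sum]
  refine IsUltrametricDist.norm_sum_le_of_forall_le_of_nonneg zero_le_one fun i _ => ?_
  rw [vecCoeff_smul, dotProduct_sum]
  refine IsUltrametricDist.norm_sum_le_of_forall_le_of_nonneg zero_le_one fun x hx => ?_
  rw [Finset.HasAntidiagonal.mem_antidiagonal] at hx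
  rw [dotProduct_smul, vecCoeff_connection_pow, Matrix.dotProduct_mulVec,
    vecMul_pow_algebraMap_add hv, smul_dotProduct, smul_eq_mul, smul_eq_mul, norm_mul, norm_mul,
    norm_pow]
  refine mul_le_one₀ (hg i _) (by positivity) (mul_le_one₀
    (pow_le_one₀ (norm_nonneg _) (Padic.norm_natCast_le_one _)) (norm_nonneg _) ?_)
  by_cases hdvd : p ∣ x.2
  · obtain ⟨m, hm⟩ := hdvd
    rw [hm, vecCoeff_mul_vecExpand]
    refine ih m ?_ (h.antecedent hn) (by rw [Matrix.vecMul_smul, hv, smul_zero]) ?_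
    · have := hp.two_le
      have h2 : 2 * m ≤ p * m := Nat.mul_le_mul_right m this
      omega
    · rwa [vecCoeff_vecCartier, mul_zero]
  · rw [vecCoeff_vecExpand_of_not_dvd hdvd]; simp

end Descent

/-! ### Rows of the Taylor matrices -/

section Companion

open Polynomial

variable {K : Type*} [Field K] {n : ℕ}

lemma coeff_iterate_eulerDeriv (f : K⟦X⟧) (i k : ℕ) :
    PowerSeries.coeff k (eulerDeriv^[i] f) = (k : K) ^ i * PowerSeries.coeff k f := by
  induction i with
  | zero => simp
  | succ i ih => rw [Function.iterate_succ_apply', coeff_eulerDeriv, ih, pow_succ']; ring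

lemma MonicDiffOp.taylorMatrix_succ_apply (L : MonicDiffOp K n) (j : ℕ) (r i : Fin n) :
    L.taylorMatrix (j + 1) r i = eulerDeriv (L.taylorMatrix j r i) +
      ∑ k, L.taylorMatrix j r k * L.companion k i + (-(j : K)) • L.taylorMatrix j r i := by
  rw [taylorMatrix, mul_sub, ← nsmul_eq_mul']
  simp only [Matrix.add_apply, Matrix.map_apply, Matrix.sub_apply, Matrix.mul_apply,
    Matrix.smul_apply, neg_smul, Nat.cast_smul_eq_nsmul]
  ring

variable {Ξ : Matrix (Fin n) (Fin n) K} {y : Fin n → K⟦X⟧}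

lemma MonicDiffOp.cyclicComb_companion {L : MonicDiffOp K n}
    (hy : (connection Ξ ^ n) y = cyclicComb Ξ y (-L.coeff)) (k : Fin n) :
    cyclicComb Ξ y (L.companion k) = (connection Ξ ^ ((k : ℕ) + 1)) y := by
  rcases Nat.lt_or_ge ((k : ℕ) + 1) n with h | h
  · rw [← cyclicComb_single Ξ y ⟨k + 1, h⟩]
    congr 1
    ext1 i
    rw [companion, Pi.single_apply]
    simp only [Fin.ext_iff, h.ne, if_false, eq_comm]
  · have hk : (k : ℕ) + 1 = n := by omega
    rw [hk, hy]
    congr 1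
    ext1 i
    rw [companion, if_neg (by omega), if_pos hk, Pi.neg_apply]

/-- The rows of the matrices `A_j` are the coordinates of `∇ (∇ - 1) ⋯ (∇ - j + 1)` applied to the
basis `∇ ^ i y`; only the first row is needed. -/
lemma MonicDiffOp.cyclicComb_taylorMatrix {L : MonicDiffOp K n}
    (hy : (connection Ξ ^ n) y = cyclicComb Ξ y (-L.coeff)) (hn : 0 < n) (j : ℕ) :
    cyclicComb Ξ y (L.taylorMatrix j ⟨0, hn⟩) =
      aeval (connection Ξ) (descPochhammer K j) y := by
  induction j with
  | zero =>
    have : L.taylorMatrix 0 ⟨0, hn⟩ = Pi.single ⟨0, hn⟩ 1 := by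
      ext1 i
      rw [taylorMatrix, Matrix.one_apply, Pi.single_apply]
      simp only [eq_comm]
    rw [this, cyclicComb_single]; simp
  | succ j ih =>
    have h1 : L.taylorMatrix (j + 1) ⟨0, hn⟩ = (fun i => eulerDeriv (L.taylorMatrix j ⟨0, hn⟩ i)) +
        ∑ k, L.taylorMatrix j ⟨0, hn⟩ k • L.companion k +
        (-(j : K)) • L.taylorMatrix j ⟨0, hn⟩ := by
      ext1 i
      rw [taylorMatrix_succ_apply]
      simp [Finset.sum_apply]
    rw [h1, cyclicComb_add, cyclicComb_add, cyclicComb_sum, cyclicComb_const_smul, ih]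
    simp only [cyclicComb_smul, cyclicComb_companion hy]
    rw [descPochhammer_succ_right, mul_comm, map_mul, Module.End.mul_apply, map_sub, aeval_X,
      map_natCast, LinearMap.sub_apply, sub_eq_add_neg, neg_smul, Module.End.natCast_apply,
      Nat.cast_smul_eq_nsmul]
    congr 1
    rw [← ih, cyclicComb, cyclicComb, map_sum, ← Finset.sum_add_distrib]
    refine Finset.sum_congr rfl fun i _ => ?_
    rw [connection_smul, pow_succ', Module.End.mul_apply]

end Companion

/-! ### The method of Frobenius -/

section FrobeniusMethod

open Polynomial

variable {K : Type*} [Field K] [CharZero K] {n : ℕ}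

lemma isUnit_algebraMap_add {Ξ : Matrix (Fin n) (Fin n) K} (hΞ : Ξ ^ n = 0) {k : ℕ} (hk : k ≠ 0) :
    IsUnit (algebraMap K (Matrix (Fin n) (Fin n) K) (k : K) + Ξ) := by
  have hu : IsUnit (algebraMap K (Matrix (Fin n) (Fin n) K) (k : K)) :=
    (IsUnit.mk0 _ (by exact_mod_cast hk)).map _
  rw [add_comm]
  exact IsNilpotent.isUnit_add_right_of_commute ⟨n, hΞ⟩ hu (Algebra.commutes _ _).symm

/-- A sequence may be defined by strong recursion. -/
lemma exists_strong_rec {V : Type*} [Zero V] (F : ℕ → (ℕ → V) → V) :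
    ∃ Y : ℕ → V, ∀ k, Y k = F k fun m => if m < k then Y m else 0 := by
  let G : ∀ k, (∀ m, m < k → V) → V := fun k ih => F k fun m => if h : m < k then ih m h else 0
  refine ⟨Nat.lt_wfRel.wf.fix G, fun k => ?_⟩
  rw [WellFounded.fix_eq]
  simp only [G, dite_eq_ite]

/-- The method of Frobenius: an operator with maximal unipotent monodromy has a solution `y z ^ Ξ`
with prescribed `y(0)`, for each nilpotent exponent matrix `Ξ`. -/
lemma exists_frobenius_solution {Ξ : Matrix (Fin n) (Fin n) K} (hΞ : Ξ ^ n = 0)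
    {a : Fin n → K⟦X⟧} (ha : ∀ i, PowerSeries.constantCoeff (a i) = 0) (e : Fin n → K) :
    ∃ y : Fin n → K⟦X⟧, vecCoeff 0 y = e ∧ (connection Ξ ^ n) y = cyclicComb Ξ y a := by
  let A : ℕ → Matrix (Fin n) (Fin n) K := fun k => algebraMap K _ (k : K) + Ξ
  obtain ⟨Y, hY⟩ := exists_strong_rec fun k (Z : ℕ → Fin n → K) => if k = 0 then e else
    ((A k ^ n)⁻¹).mulVec (∑ i : Fin n, ∑ x ∈ Finset.HasAntidiagonal.antidiagonal k,
      PowerSeries.coeff x.1 (a i) • (A x.2 ^ (i : ℕ)).mulVec (Z x.2))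
  let y : Fin n → K⟦X⟧ := fun l => PowerSeries.mk fun k => Y k l
  have hyY : ∀ k, vecCoeff k y = Y k := fun k => by ext l; simp [vecCoeff_apply, y]
  refine ⟨y, by rw [hyY, hY]; simp, vecCoeff_ext fun k => ?_⟩
  have hR : vecCoeff k (cyclicComb Ξ y a) =
      ∑ i : Fin n, ∑ x ∈ Finset.HasAntidiagonal.antidiagonal k,
        PowerSeries.coeff x.1 (a i) • (A x.2 ^ (i : ℕ)).mulVec (Y x.2) := by
    simp only [cyclicComb, map_sum, vecCoeff_smul, vecCoeff_connection_pow, hyY, A]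
  rw [hR, vecCoeff_connection_pow, hyY]
  rcases eq_or_ne k 0 with rfl | hk
  · simp [ha, hΞ]
  · have hdet : IsUnit (A k ^ n).det :=
      (Matrix.isUnit_iff_isUnit_det _).1 ((isUnit_algebraMap_add hΞ hk).pow n)
    rw [hY k, if_neg hk]
    change (A k ^ n).mulVec _ = _
    rw [Matrix.mulVec_mulVec, Matrix.mul_nonsing_inv _ hdet, Matrix.one_mulVec]
    refine Finset.sum_congr rfl fun i _ => Finset.sum_congr rfl fun x hx => ?_
    rw [Finset.HasAntidiagonal.mem_antidiagonal] at hx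
    rcases Nat.lt_or_ge x.2 k with h | h
    · simp only [if_pos h]
    · have : x.1 = 0 := by omega
      simp [this, ha]

/-- An operator with maximal unipotent monodromy has at most one power series solution with a given
constant term. -/
lemma MonicDiffOp.IsMUM.eq_of_apply_eq_zero {L : MonicDiffOp K n} (hL : L.IsMUM) {f g : K⟦X⟧}
    (hf : L.apply f = 0) (hg : L.apply g = 0)
    (h0 : PowerSeries.constantCoeff f = PowerSeries.constantCoeff g) : f = g := by
  have hcoeff : ∀ {f : K⟦X⟧} (k : ℕ), L.apply f = 0 → (k : K) ^ n * PowerSeries.coeff k f =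
      -∑ i : Fin n, ∑ x ∈ Finset.HasAntidiagonal.antidiagonal k,
        PowerSeries.coeff x.1 (L.coeff i) * ((x.2 : K) ^ (i : ℕ) * PowerSeries.coeff x.2 f) := by
    intro f k h
    have h1 := congrArg (PowerSeries.coeff k) h
    rw [apply, map_add, map_sum, map_zero, coeff_iterate_eulerDeriv] at h1
    rw [eq_neg_iff_add_eq_zero, ← h1]
    simp only [PowerSeries.coeff_mul, coeff_iterate_eulerDeriv]
  ext k
  induction k using Nat.strong_induction_on with
  | _ k ih =>
  rcases eq_or_ne k 0 with rfl | hk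
  · simpa using h0
  have hkn : (k : K) ^ n ≠ 0 := pow_ne_zero _ (by exact_mod_cast hk)
  refine mul_left_cancel₀ hkn ?_
  rw [hcoeff k hf, hcoeff k hg]
  congr 1
  refine Finset.sum_congr rfl fun i _ => Finset.sum_congr rfl fun x hx => ?_
  rw [Finset.HasAntidiagonal.mem_antidiagonal] at hx
  rcases Nat.lt_or_ge x.2 k with h | h
  · rw [ih _ h]
  · have h1 : x.1 = 0 := by omega
    have h2 := hL i
    simp [h1, h2]

end FrobeniusMethod

/-! ### The nilpotent Jordan block -/

section LowerShift

variable {K : Type*} [Field K] {n : ℕ}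

variable (K n) in
/-- The nilpotent Jordan block with ones below the diagonal. -/
def lowerShift : Matrix (Fin n) (Fin n) K := fun l m => if (m : ℕ) + 1 = l then 1 else 0

lemma lowerShift_pow_apply (i : ℕ) (l m : Fin n) :
    (lowerShift K n ^ i) l m = if (m : ℕ) + i = l then 1 else 0 := by
  induction i generalizing m with
  | zero => simp [Matrix.one_apply, Fin.ext_iff, eq_comm]
  | succ i ih =>
    rw [pow_succ, Matrix.mul_apply]
    simp only [ih, lowerShift, mul_ite, mul_one, mul_zero]
    split_ifs with h
    · rw [Finset.sum_eq_single ⟨(m : ℕ) + 1, by omega⟩]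
      · rw [if_pos rfl, if_pos (by simp only; omega)]
      · intro r _ hr
        rw [if_neg]
        intro h'
        exact hr (Fin.ext h'.symm)
      · simp
    · refine Finset.sum_eq_zero fun r _ => ?_
      split_ifs with h1 h2
      · omega
      · rfl
      · rfl

lemma lowerShift_pow_self : lowerShift K n ^ n = 0 := by
  ext l m
  rw [lowerShift_pow_apply, if_neg (by omega), Matrix.zero_apply]

lemma isCyclicVec_lowerShift (hn : 0 < n) :
    IsCyclicVec (lowerShift K n) (Pi.single ⟨0, hn⟩ 1) := by
  intro a ha
  ext l
  have h1 := congrFun ha l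
  simpa [Finset.sum_apply, lowerShift_pow_apply, Fin.val_inj] using h1

lemma vecMul_single_zero_lowerShift (hn : 0 < n) :
    Matrix.vecMul (Pi.single ⟨0, hn⟩ 1) (lowerShift K n) = 0 := by
  ext m
  simp [lowerShift]

lemma connection_lowerShift_pow_zero (hn : 0 < n) (y : Fin n → K⟦X⟧) (i : ℕ) :
    (connection (lowerShift K n) ^ i) y ⟨0, hn⟩ = eulerDeriv^[i] (y ⟨0, hn⟩) := by
  induction i with
  | zero => rfl
  | succ i ih =>
    rw [pow_succ', Module.End.mul_apply, connection_apply, Function.iterate_succ_apply', ih]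
    simp [lowerShift]

end LowerShift

/-! ### The generic radius of convergence -/

section Radius

open Polynomial

variable {p : ℕ} [Fact p.Prime] {n : ℕ}

lemma MonicDiffOp.bddBy_taylorMatrix (L : MonicDiffOp ℤ_[p] n) (j : ℕ) (r i : Fin n) :
    BddBy 1 ((L.map (algebraMap ℤ_[p] ℚ_[p])).taylorMatrix j r i) := by
  induction j generalizing i with
  | zero =>
    rw [taylorMatrix, Matrix.one_apply]
    split_ifs
    exacts [BddBy.one, BddBy.zero zero_le_one]
  | succ j ih =>
    rw [taylorMatrix_succ_apply]
    refine ((ih i).eulerDeriv.add (BddBy.sum zero_le_one fun k _ => ?_)).add ?_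
    · have h1 : BddBy 1 ((L.map (algebraMap ℤ_[p] ℚ_[p])).companion k i) := by
        rw [companion]
        split_ifs
        · exact BddBy.one
        · rw [map, ← map_neg]
          exact bddBy_map _
        · exact BddBy.zero zero_le_one
      simpa using (ih k).mul zero_le_one zero_le_one h1
    · have h1 : ‖-(j : ℚ_[p])‖ ≤ 1 := by rw [norm_neg]; exact Padic.norm_natCast_le_one j
      simpa using (ih i).smul h1

lemma norm_coeff_le_of_matrixGaussENorm_le {M : Matrix (Fin n) (Fin n) ℚ_[p]⟦X⟧} {B : ℝ}
    (hB : 0 ≤ B) (h : matrixGaussENorm M ≤ ENNReal.ofReal B) (r i : Fin n) : BddBy B (M r i) := by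
  intro k
  have h1 : ‖PowerSeries.coeff k (M r i)‖ₑ ≤ matrixGaussENorm M :=
    (le_iSup (fun k => ‖PowerSeries.coeff k (M r i)‖ₑ) k).trans
      ((le_iSup (fun i => gaussENorm (M r i)) i).trans
        (le_iSup (fun r => ⨆ i, gaussENorm (M r i)) r))
  have h2 := h1.trans h
  rwa [← ofReal_norm, ENNReal.ofReal_le_ofReal_iff hB] at h2

lemma MonicDiffOp.exists_bddBy_of_one_le_genericRadius (L : MonicDiffOp ℤ_[p] n)
    (hr : 1 ≤ (L.map (algebraMap ℤ_[p] ℚ_[p])).genericRadius) {ρ : ℝ} (hρ : 1 < ρ) :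
    ∃ C : ℝ, 0 ≤ C ∧ ∀ j r i, BddBy (C * ρ ^ j)
      (((j.factorial : ℚ_[p])⁻¹) • (L.map (algebraMap ℤ_[p] ℚ_[p])).taylorMatrix j r i) := by
  have hρ0 : 0 < ρ := one_pos.trans hρ
  rw [genericRadius, ENNReal.one_le_inv] at hr
  have hlt := hr.trans_lt (ENNReal.one_lt_ofReal.2 hρ)
  obtain ⟨J, hJ⟩ := Filter.eventually_atTop.1 (Filter.eventually_lt_of_limsup_lt hlt)
  set D : ℝ := ∑ j ∈ Finset.range (J + 1), ‖((j.factorial : ℚ_[p])⁻¹)‖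
  have hD : 0 ≤ D := Finset.sum_nonneg fun _ _ => norm_nonneg _
  refine ⟨D + 1, by positivity, fun j r i => ?_⟩
  rcases Nat.lt_or_ge J j with hj | hj
  · have hj0 : (j : ℝ) ≠ 0 := by
      have : j ≠ 0 := by omega
      exact_mod_cast this
    have h1 := ENNReal.rpow_le_rpow (hJ j hj.le).le (Nat.cast_nonneg j : (0 : ℝ) ≤ j)
    rw [← ENNReal.rpow_mul, one_div, inv_mul_cancel₀ hj0, ENNReal.rpow_one, ENNReal.rpow_natCast,
      ← ENNReal.ofReal_pow hρ0.le] at h1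
    have h2 := norm_coeff_le_of_matrixGaussENorm_le (by positivity) h1 r i
    rw [Matrix.smul_apply, smul_eq_mul, ← PowerSeries.smul_eq_C_mul] at h2
    refine h2.mono (le_mul_of_one_le_left (by positivity) (by linarith))
  · have h1 := (L.bddBy_taylorMatrix j r i).smul (c := (j.factorial : ℚ_[p])⁻¹) le_rfl
    refine h1.mono ?_
    have h2 : ‖((j.factorial : ℚ_[p])⁻¹)‖ ≤ D :=
      Finset.single_le_sum (f := fun j : ℕ => ‖((j.factorial : ℚ_[p])⁻¹)‖)
        (fun _ _ => norm_nonneg _) (Finset.mem_range.2 (by omega))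
    have h3 : 1 ≤ ρ ^ j := one_le_pow₀ hρ.le
    nlinarith [norm_nonneg ((j.factorial : ℚ_[p])⁻¹)]

lemma MonicDiffOp.IsMUM.map {R S : Type*} [CommRing R] [CommRing S] {L : MonicDiffOp R n}
    (hL : L.IsMUM) (φ : R →+* S) : (L.map φ).IsMUM := fun i => by
  rw [MonicDiffOp.map, ← PowerSeries.coeff_zero_eq_constantCoeff_apply, PowerSeries.coeff_map,
    PowerSeries.coeff_zero_eq_constantCoeff_apply, hL i, map_zero]

/-- The Frobenius basis of solutions of an integral operator with maximal unipotent monodromy and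
generic radius of convergence at least one. -/
lemma MonicDiffOp.IsMUM.exists_isGoodCyclic {L : MonicDiffOp ℤ_[p] n} (hL : L.IsMUM) (hn : 0 < n)
    (hr : 1 ≤ (L.map (algebraMap ℤ_[p] ℚ_[p])).genericRadius) :
    ∃ y : Fin n → ℚ_[p]⟦X⟧, vecCoeff 0 y = Pi.single ⟨0, hn⟩ 1 ∧
      (connection (lowerShift ℚ_[p] n) ^ n) y =
        cyclicComb (lowerShift ℚ_[p] n) y (-(L.map (algebraMap ℤ_[p] ℚ_[p])).coeff) ∧
      IsGoodCyclic (lowerShift ℚ_[p] n) y := by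
  obtain ⟨y, hy0, hy⟩ := exists_frobenius_solution (K := ℚ_[p]) (lowerShift_pow_self (n := n))
    (a := -(L.map (algebraMap ℤ_[p] ℚ_[p])).coeff) (fun i => by
      rw [Pi.neg_apply, map_neg, (hL.map _) i, neg_zero]) (Pi.single ⟨0, hn⟩ 1)
  refine ⟨y, hy0, hy, lowerShift_pow_self, hy0 ▸ isCyclicVec_lowerShift hn, ?_, ?_⟩
  · refine ⟨_, fun i => ?_, hy.symm⟩
    rw [Pi.neg_apply, MonicDiffOp.map, ← map_neg]
    exact bddBy_map _
  · intro ρ hρ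
    obtain ⟨C, hC, hCb⟩ := L.exists_bddBy_of_one_le_genericRadius hr hρ
    refine ⟨C, hC, fun j => ⟨((j.factorial : ℚ_[p])⁻¹) •
      (L.map (algebraMap ℤ_[p] ℚ_[p])).taylorMatrix j ⟨0, hn⟩, fun i => hCb j _ i, ?_⟩⟩
    rw [cyclicComb_const_smul, MonicDiffOp.cyclicComb_taylorMatrix hy hn, binomPoly, map_mul,
      aeval_C, Module.End.mul_apply, Module.algebraMap_end_apply]

end Radius

end

theorem theorem3p2 (p : ℕ) [Fact p.Prime] (n : ℕ) (hn : 1 ≤ n)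
    (L : MonicDiffOp ℤ_[p] n) (hMUM : L.IsMUM)
    (hr : 1 ≤ (L.map (algebraMap ℤ_[p] ℚ_[p])).genericRadius) :
    (∃! f : PowerSeries ℚ_[p], PowerSeries.constantCoeff f = 1 ∧
        (L.map (algebraMap ℤ_[p] ℚ_[p])).apply f = 0) ∧
      ∀ y₀ : PowerSeries ℚ_[p], PowerSeries.constantCoeff y₀ = 1 →
        (L.map (algebraMap ℤ_[p] ℚ_[p])).apply y₀ = 0 →
        ∃ g : PowerSeries ℤ_[p], PowerSeries.constantCoeff g = 1 ∧
          PowerSeries.map (algebraMap ℤ_[p] ℚ_[p]) g = y₀ := by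
  obtain ⟨y, hy0, hy, hgood⟩ := hMUM.exists_isGoodCyclic hn hr
  have hconst : PowerSeries.constantCoeff (y ⟨0, hn⟩) = 1 := by
    simpa [vecCoeff_apply] using congrFun hy0 ⟨0, hn⟩
  have hsol : (L.map (algebraMap ℤ_[p] ℚ_[p])).apply (y ⟨0, hn⟩) = 0 := by
    have h1 := congrFun hy ⟨0, hn⟩
    rw [connection_lowerShift_pow_zero] at h1
    rw [MonicDiffOp.apply, h1, cyclicComb]
    simp [Finset.sum_apply, connection_lowerShift_pow_zero]
  have huniq : ∀ f : PowerSeries ℚ_[p], PowerSeries.constantCoeff f = 1 →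
      (L.map (algebraMap ℤ_[p] ℚ_[p])).apply f = 0 → f = y ⟨0, hn⟩ := fun f h1 h2 =>
    (hMUM.map _).eq_of_apply_eq_zero h2 hsol (h1.trans hconst.symm)
  refine ⟨⟨y ⟨0, hn⟩, ⟨hconst, hsol⟩, fun f hf => huniq f hf.1 hf.2⟩, fun f h1 h2 => ?_⟩
  obtain rfl := huniq f h1 h2
  have hint : BddBy 1 (y ⟨0, hn⟩) := fun k => by
    have := hgood.norm_dotProduct_le_one hn k (vecMul_single_zero_lowerShift hn) (by simp [hy0])
    simpa [vecCoeff_apply] using this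
  obtain ⟨g, hg⟩ := hint.exists_map
  refine ⟨g, IsFractionRing.injective ℤ_[p] ℚ_[p] ?_, hg⟩
  rw [map_one, ← hconst, ← hg, ← PowerSeries.coeff_zero_eq_constantCoeff_apply,
    ← PowerSeries.coeff_zero_eq_constantCoeff_apply, PowerSeries.coeff_map]
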